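/- \textbf{Setting.} There are $n$ asynchronous processes $p_1,\dots,p_n$, at most $f<n$ of which are faulty; the other processes are \emph{correct}. In the crash model every process follows its code and a faulty process stops taking steps at some time; in the Byzantine model a faulty process behaves arbitrarily. $\mathbb T$ is the set of tasks, partitioned into sets $\mathbb T_i$ (the tasks that $p_i$ may submit), and $\mathbb V$ is the set of results; each task has at least one valid result, and $\mathsf{execute}(t)$, run by a process that follows its code, returns a valid result of $t$; at a correct process it always ends. \textbf{The deque object.} Let $C=\{\mathsf{addResult}_{t,r}: r\text{ is a valid result for }t\}$, $O_i=\{\mathsf{pushBottom}_{i,t},\mathsf{remove}_{i,t}: t\in\mathbb T_i\}\cup\{\mathsf{popBottom}_i\}$, $\Sigma=C\cup\bigcup_i O_i$, $I=\Sigma^2\setminus\bigcup_i O_i^2$, and let $\mathbb M(\Sigma,I)$ be the monoid of words over $\Sigma$ up to exchange of adjacent independent letters. For a trace $v$ let $d_i(v)$ be the sequence of tasks obtained from the empty one when $\mathsf{pushBottom}_{i,t}$ appends $t$, $\mathsf{popBottom}_i$ deletes the first element, $\mathsf{remove}_{i,t}$ deletes all occurrences of $t$, and other letters do nothing; $d_i(v)=\bot$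 if a $\mathsf{popBottom}_i$ meets the empty sequence. $L$ is the set of traces in which each $\mathsf{pushBottom}_{i,t}$ occurs at most once and with $d_i(v)\ne\bot$ for all $i$. The queries $\mathsf{getBottom}_i,\mathsf{getTop}_i,\mathsf{getPending}_i$ return the first element, the last element and the set of elements of $d_i(v)$ ($\bot$ if there is no such element), and $\mathsf{getResults}_t$ the set of $r$ with $\mathsf{addResult}_{t,r}$ in $v$. The update $\mathsf{popBottom}_i$, applied in state $v$, outputs the first element of $d_i(v)$; the other updates are silent. \textbf{The object algorithm} (code for $p_i$). Variables: a word $seq_i$ over $\Sigma$, a number $sn_i$, numbers $del_i[1..n]$, initially empty and $0$. A query is evaluated on $[seq_i]$. To apply an update $up$: if $up\in C\cup O_i$ and $[seq_i\,up]\in L$, increment $sn_i$, reliably broadcast $\langle sn_i,up\rangle$, wait until $del_i[i]=sn_i$, and return the output of $up$ in the state to which it was applied; otherwise abort (and block). When $\langle sn,up\rangle$ is delivered from $p_j$: wait until $up\in C\cup O_j$, $sn=del_i[j]+1$ and $[seq_i\,up]\in L$; then append $up$ to $seq_i$ and set $del_i[j]:=sn$. Reliable broadcast means: (validity) what $p_i$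 delivers from $p_j$ with number $sn$ has been broadcast by $p_j$ with number $sn$; (integrity) $p_i$ delivers at most one message per sender and sequence number; (termination) a correct process delivers its own broadcasts, and a message delivered by some process is delivered by all correct ones. In the Byzantine model these properties are only required of correct processes ($p_i,p_j$ and the ``some process''); no further bound such as $f<n/3$, needed to implement such a broadcast, is used. \textbf{The work-stealing client} (code for $p_i$). It consists of four blocks executed in mutual exclusion: (0) $\mathsf{submit\_task}(t)$, called by the application: apply $\mathsf{pushBottom}_{i,t}$. (1) When $\mathsf{getBottom}_i\neq\bot$: $t\leftarrow\mathsf{popBottom}_i$; $r\leftarrow\mathsf{execute}(t)$; $\mathsf{publish\_result}(t,r)$. (2) When $\mathsf{getBottom}_i=\bot$ and $\mathsf{getTop}_j\ne\bot$ for some $j\ne i$ (chosen arbitrarily): $t\leftarrow\mathsf{getTop}_j$; $r\leftarrow\mathsf{execute}(t)$; apply $\mathsf{addResult}_{t,r}$. (If in the meantime $\mathsf{getTop}_j$ has become $\bot$, the block ends.) (3) When some $t\in\mathsf{getPending}_i$ has $\mathsf{getResults}_t\ne\emptyset$: apply $\mathsf{remove}_{i,t}$; choose $r\in\mathsf{getResults}_t$;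 $\mathsf{publish\_result}(t,r)$. Scheduling at a correct process is fair: a statement of a running block, or a waiting delivered message, that stays enabled is eventually executed, resp. processed; and, provided that no block is running at arbitrarily late times, a block that stays activated from some time on (a call of $\mathsf{submit\_task}(t)$ that is waiting, or a handler whose condition holds continuously) is eventually executed. \textbf{Theorem.} Consider an execution of the work-stealing client in the crash or in the Byzantine model, and a correct process $p_i$ whose application submits only tasks of $\mathbb T_i$, none of them more than once. If $p_i$ invokes $\mathsf{submit\_task}$ finitely many times, then for each task $t$ submitted by $p_i$ there is exactly one time at which $p_i$ invokes $\mathsf{publish\_result}(t,\cdot)$; this time is later than the submission, and the published result is a valid result of $t$. Moreover $t$ has been executed before it: either some process that follows its code (any process in the crash model, a correct one in the Byzantine model) has completed an $\mathsf{execute}(t)$ between the submission and the publication, or, in the Byzantine model only, $p_i$ has before the publication processed an update $\mathsf{addResult}_{t,r'}$, with $r'$ a valid result of $t$, broadcast by a Byzantine process (whose internal computations cannot be observed). -/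

import Mathlib

namespace WorkStealing

universe u v

/-! ### The alphabet of the multiple idempotent work stealing deque -/

/-- The operation names `pushBottom_{i,t}`, `popBottom_i`, `remove_{i,t}`, `addResult_{t,r}`, with no
restriction on `i`, `t`, `r` (a message of a Byzantine process may carry any of them). -/
inductive Op (n : ℕ) (T : Type u) (V : Type v) : Type (max u v)
  | pushBottom (i : Fin n) (t : T)
  | popBottom (i : Fin n)
  | remove (i : Fin n) (t : T)
  | addResult (t : T) (r : V)

/-- The application: `n` processes, tasks `T`, results `V`. Task identifiers are partitioned between
the processes, `T_i` being the tasks with `owner t = i`; `Valid t r` says that `r` is a valid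
result for the task `t`. -/
structure App (n : ℕ) (T : Type u) (V : Type v) where
  owner : T → Fin n
  Valid : T → V → Prop

variable {n : ℕ} {T : Type u} {V : Type v}

/-- The common updates `C`. -/
def App.C (W : App n T V) : Set (Op n T V) :=
  {op | ∃ t r, W.Valid t r ∧ op = .addResult t r}

/-- The updates `O_i` that are exclusive to the process `i`. -/
def App.O (W : App n T V) (i : Fin n) : Set (Op n T V) :=
  {op | (∃ t, W.owner t = i ∧ (op = .pushBottom i t ∨ op = .remove i t)) ∨ op = .popBottom i}

/-- The alphabet `Σ = C ∪ ⋃ i, O_i`. -/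
def App.Sigma (W : App n T V) : Set (Op n T V) := W.C ∪ ⋃ i, W.O i

/-- The independency relation `I = Σ × Σ \ ⋃ i, O_i × O_i`. -/
def App.Indep (W : App n T V) (a b : W.Sigma) : Prop :=
  ¬ ∃ i, (a : Op n T V) ∈ W.O i ∧ (b : Op n T V) ∈ W.O i

/-- The generating relations `a b = b a` for independent letters `a`, `b`. -/
def App.swap (W : App n T V) (x y : FreeMonoid W.Sigma) : Prop :=
  ∃ a b : W.Sigma, W.Indep a b ∧
    x = FreeMonoid.of a * FreeMonoid.of b ∧ y = FreeMonoid.of b * FreeMonoid.of a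

/-- The trace monoid `M(Σ, I)`: words over `Σ` up to the exchange of adjacent independent letters. -/
abbrev App.Trace (W : App n T V) : Type (max u v) := PresentedMonoid W.swap

/-- The trace `[w]_I` of a word `w`. -/
def App.trace (W : App n T V) (w : List W.Sigma) : W.Trace :=
  PresentedMonoid.mk W.swap (FreeMonoid.ofList w)

/-- A one-letter trace. -/
def App.letter (W : App n T V) (a : W.Sigma) : W.Trace := PresentedMonoid.of W.swap a

/-! ### The content of a deque -/

open Classical in
/-- The effect of one update on the content of the deque of process `i`; `none` is the non-value `⊥`,
and an update that is not one of `pushBottom_{i,t}`, `popBottom_i`, `remove_{i,t}` has no effect. -/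
noncomputable def act (i : Fin n) : Op n T V → Option (List T) → Option (List T)
  | _, none => none
  | .pushBottom j t, some s => if j = i then some (s ++ [t]) else some s
  | .popBottom j, some s =>
      if j = i then (match s with | [] => none | _ :: s' => some s') else some s
  | .remove j t, some s => if j = i then some (s.filter (fun t' => t' ≠ t)) else some s
  | .addResult _ _, some s => some s

theorem act_eq_self (W : App n T V) (i : Fin n) (a : W.Sigma) (h : (a : Op n T V) ∉ W.O i)
    (s : Option (List T)) : act i (a : Op n T V) s = s := by
  obtain ⟨a, ha⟩ := a
  rcases s with _ | s
  · cases a <;> rfl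
  · have key : ∀ j, a ∈ W.O j → j ≠ i := fun j hj hji => h (hji ▸ hj)
    have hO : (∃ t r, a = .addResult t r) ∨ ∃ j, a ∈ W.O j := by
      rcases ha with ⟨t, r, _, rfl⟩ | ha
      · exact Or.inl ⟨t, r, rfl⟩
      · exact Or.inr (Set.mem_iUnion.1 ha)
    rcases hO with ⟨t, r, rfl⟩ | ⟨j, hj⟩
    · rfl
    · have hne := key j hj
      rcases hj with ⟨t, _, rfl | rfl⟩ | rfl <;> simp [act, hne]

/-- The action of traces on the contents of the deque of process `i`, letters acting from left to
right. -/
noncomputable def App.dAct (W : App n T V) (i : Fin n) :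
    W.Trace →* (Function.End (Option (List T)))ᵐᵒᵖ :=
  PresentedMonoid.lift (rels := W.swap)
    (fun a : W.Sigma => (MulOpposite.op (act i (a : Op n T V)) :
      (Function.End (Option (List T)))ᵐᵒᵖ)) (by
    rintro x y ⟨a, b, hab, rfl, rfl⟩
    simp only [map_mul, FreeMonoid.lift_eval_of]
    apply MulOpposite.unop_injective
    funext s
    change act i (b : Op n T V) (act i (a : Op n T V) s) =
      act i (a : Op n T V) (act i (b : Op n T V) s)
    by_cases ha : (a : Op n T V) ∈ W.O i
    · have hb : (b : Op n T V) ∉ W.O i := fun hb => hab ⟨i, ha, hb⟩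
      rw [act_eq_self W i b hb, act_eq_self W i b hb]
    · rw [act_eq_self W i a ha, act_eq_self W i a ha])

/-- `d_state(i, v)`: the content of the deque of process `i` after the trace `v`, or `⊥` (`none`). -/
noncomputable def App.dState (W : App n T V) (i : Fin n) (v : W.Trace) : Option (List T) :=
  (W.dAct i v).unop (some [])

theorem App.dState_one (W : App n T V) (i : Fin n) : W.dState i 1 = some [] := by
  simp only [App.dState, map_one, MulOpposite.unop_one]
  rfl

theorem App.dState_mul_letter (W : App n T V) (i : Fin n) (v : W.Trace) (a : W.Sigma) :
    W.dState i (v * W.letter a) = act i (a : Op n T V) (W.dState i v) := by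
  simp only [App.dState, map_mul, MulOpposite.unop_mul]
  rfl

open Classical in
/-- The number of occurrences of the letter `a` in a trace. -/
noncomputable def App.countHom (W : App n T V) (a : W.Sigma) : W.Trace →* Multiplicative ℕ :=
  PresentedMonoid.lift (rels := W.swap) (fun b : W.Sigma =>
    Multiplicative.ofAdd (if b = a then 1 else 0)) (by
    rintro x y ⟨b, c, _, rfl, rfl⟩
    simp only [map_mul, FreeMonoid.lift_eval_of]
    exact mul_comm _ _)

/-- The number of occurrences of the letter `a` in a trace. -/
noncomputable def App.count (W : App n T V) (a : W.Sigma) (v : W.Trace) : ℕ :=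
  Multiplicative.toAdd (W.countHom a v)

/-- The trace language `L`: every `pushBottom_{i,t}` occurs at most once, and no deque is in the
state `⊥`. -/
def App.L (W : App n T V) : Set W.Trace :=
  {v | (∀ (a : W.Sigma) (i : Fin n) (t : T), (a : Op n T V) = .pushBottom i t → W.count a v ≤ 1) ∧
    ∀ i, W.dState i v ≠ none}

/-! ### Queries and outputs (`none` stands for the non-value `⊥`) -/

/-- `getBottom_i(v)`, the first element of the content of the deque. -/
noncomputable def App.getBottom (W : App n T V) (i : Fin n) (v : W.Trace) : Option T :=
  (W.dState i v).bind List.head?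

/-- `getTop_i(v)`, the last element of the content of the deque. -/
noncomputable def App.getTop (W : App n T V) (i : Fin n) (v : W.Trace) : Option T :=
  (W.dState i v).bind List.getLast?

/-- `getPending_i(v)`, the set of the tasks in the deque. -/
def App.getPending (W : App n T V) (i : Fin n) (v : W.Trace) : Set T :=
  {t | ∃ s, W.dState i v = some s ∧ t ∈ s}

/-- `getResults_t(v)`, the set of the results published for `t`. -/
def App.getResults (W : App n T V) (t : T) (v : W.Trace) : Set V :=
  {r | ∃ a : W.Sigma, (a : Op n T V) = .addResult t r ∧ 0 < W.count a v}

/-- `output(up, v)`: the value returned by the update `up` when it is applied to the state `v`.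
All updates but `popBottom_i` are silent. -/
noncomputable def App.output (W : App n T V) : Op n T V → W.Trace → Option T
  | .popBottom i, v => (W.dState i v).bind List.head?
  | _, _ => none

/-! ### The local algorithm of one process

Each process runs the generic object algorithm (`apply` and the handler of `r_delivered`) and, on top
of it, the work stealing client. -/

/-- Where the monitor of the work stealing client stands. -/
inductive PC (n : ℕ) (T : Type u) (V : Type v) : Type (max u v)
  /-- The monitor is free. -/
  | idle
  /-- About to invoke `apply(up)`. -/
  | call (up : Op n T V)
  /-- Inside `apply(up)`: the update has been r-broadcast, waiting for `del_i[i] = sn_i`. -/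
  | wait (up : Op n T V)
  /-- In the stealing handler with victim `j`, about to evaluate `t ← apply(getTop_j)`. -/
  | steal (j : Fin n)
  /-- Running `execute(t)` for a task popped from the local deque. -/
  | execLocal (t : T)
  /-- Running `execute(t)` for a stolen task. -/
  | execRemote (t : T)
  /-- About to choose a value from `apply(getResults_t)`. -/
  | choose (t : T)
  /-- About to invoke `publish_result(t, r)`. -/
  | publish (t : T) (r : V)
  /-- `apply` has raised `abort`; the client is blocked. -/
  | aborted

/-- The local state of a process. -/
structure LState (W : App n T V) where
  /-- `seq_i`, the updates processed so far. -/
  seq : List W.Sigma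
  /-- `sn_i`, the number of messages broadcast so far. -/
  sn : ℕ
  /-- `del_i`. -/
  del : Fin n → ℕ
  /-- The triples `(j, sn, up)` such that `⟨sn, APPLY(up)⟩` has been r-delivered from `j` and still
  waits to be processed. -/
  buf : Set (Fin n × ℕ × Op n T V)
  /-- The output of the last update of the process itself that it has processed. -/
  out : Option T
  /-- The calls of `submit_task` waiting for the monitor. -/
  pending : Multiset T
  pc : PC n T V

/-- The initial local state. -/
def LState.init (W : App n T V) : LState W where
  seq := []
  sn := 0
  del := fun _ => 0
  buf := ∅
  out := none
  pending := 0
  pc := .idle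

/-- The events of a process. -/
inductive Event (n : ℕ) (T : Type u) (V : Type v) : Type (max u v)
  /-- The application invokes `submit_task(t)`. -/
  | invoke (t : T)
  /-- `⟨sn, APPLY(up)⟩` is r-delivered from `j`. -/
  | rdeliver (j : Fin n) (sn : ℕ) (up : Op n T V)
  /-- The update `up` with sequence number `sn` of `j` leaves the waiting statement of the
  r-delivery handler and is appended to `seq_i`. -/
  | process (j : Fin n) (sn : ℕ) (up : Op n T V)
  /-- A waiting call of `submit_task(t)` enters the monitor. -/
  | enterSubmit (t : T)
  /-- The handler for local tasks enters the monitor. -/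
  | enterLocal
  /-- The stealing handler enters the monitor, with victim `j`. -/
  | enterSteal (j : Fin n)
  /-- The handler for remote results enters the monitor, for the task `t`. -/
  | enterCollect (t : T)
  /-- `apply(up)` passes its test and r-broadcasts `⟨sn, APPLY(up)⟩`. -/
  | rbroadcast (sn : ℕ) (up : Op n T V)
  /-- `apply` fails its test. -/
  | abort
  /-- `apply(up)` returns. -/
  | applyReturn (up : Op n T V)
  /-- `t ← apply(getTop_j)` in the stealing handler. -/
  | readTop
  /-- A run of `execute(t)` ends with the result `r`. -/
  | execute (t : T) (r : V)
  /-- `r` is chosen from `apply(getResults_t)`. -/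
  | choose (t : T) (r : V)
  /-- The callback `publish_result(t, r)`. -/
  | publish (t : T) (r : V)

/-- The events that continue a block of the client that is already in the monitor. -/
def Event.InBlock : Event n T V → Prop
  | .rbroadcast _ _ | .abort | .applyReturn _ | .readTop | .execute _ _ | .choose _ _ | .publish _ _ =>
      True
  | _ => False

/-- The test made by `apply(up)` at process `i`: `up ∈ C ∪ O_i` and `[seq_i ⊕ up]_I ∈ L`. The same
test is made, for the sender `i`, before an r-delivered update is processed. -/
def Admissible (W : App n T V) (i : Fin n) (seq : List W.Sigma) (a : W.Sigma) : Prop :=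
  (a : Op n T V) ∈ W.C ∪ W.O i ∧ W.trace (seq ++ [a]) ∈ W.L

/-- The statement that follows `apply(up)` in the client, when the call returns `o`. -/
def afterApply : Op n T V → Option T → PC n T V
  | .pushBottom _ _, _ => .idle
  | .popBottom _, some t => .execLocal t
  | .popBottom _, none => .aborted
  | .remove _ t, _ => .choose t
  | .addResult _ _, _ => .idle

/-- The condition of the handler for local tasks. -/
def GuardLocal (W : App n T V) (i : Fin n) (s : LState W) : Prop :=
  W.getBottom i (W.trace s.seq) ≠ none

/-- The condition of the stealing handler, with victim `j`. -/
def GuardSteal (W : App n T V) (i j : Fin n) (s : LState W) : Prop :=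
  W.getBottom i (W.trace s.seq) = none ∧ j ≠ i ∧ W.getTop j (W.trace s.seq) ≠ none

/-- The condition of the handler for remote results, for the task `t`. -/
def GuardCollect (W : App n T V) (i : Fin n) (t : T) (s : LState W) : Prop :=
  t ∈ W.getPending i (W.trace s.seq) ∧ (W.getResults t (W.trace s.seq)).Nonempty

open Classical in
/-- The steps of a process `i` that follows its code. -/
inductive Step (W : App n T V) (i : Fin n) : LState W → Event n T V → LState W → Prop
  -- calls of the application, and messages handed over by the reliable broadcast
  | invoke (s : LState W) (t : T) :
      Step W i s (.invoke t) { s with pending := t ::ₘ s.pending }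
  | rdeliver (s : LState W) (j : Fin n) (sn : ℕ) (up : Op n T V) :
      Step W i s (.rdeliver j sn up) { s with buf := insert (j, sn, up) s.buf }
  -- the handler of `r_delivered`, which runs concurrently with the client
  | process (s : LState W) (j : Fin n) (sn : ℕ) (a : W.Sigma)
      (hbuf : (j, sn, (a : Op n T V)) ∈ s.buf) (hsn : sn = s.del j + 1)
      (hadm : Admissible W j s.seq a) :
      Step W i s (.process j sn a)
        { s with
          seq := s.seq ++ [a]
          del := Function.update s.del j sn
          buf := s.buf \ {(j, sn, (a : Op n T V))}
          out := if j = i then W.output a (W.trace s.seq) else s.out }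
  -- entering one of the four blocks of the client
  | enterSubmit (s : LState W) (t : T) (p : Multiset T) (hpc : s.pc = .idle)
      (hp : s.pending = t ::ₘ p) :
      Step W i s (.enterSubmit t) { s with pending := p, pc := .call (.pushBottom i t) }
  | enterLocal (s : LState W) (hpc : s.pc = .idle) (hg : GuardLocal W i s) :
      Step W i s .enterLocal { s with pc := .call (.popBottom i) }
  | enterSteal (s : LState W) (j : Fin n) (hpc : s.pc = .idle) (hg : GuardSteal W i j s) :
      Step W i s (.enterSteal j) { s with pc := .steal j }
  | enterCollect (s : LState W) (t : T) (hpc : s.pc = .idle) (hg : GuardCollect W i t s) :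
      Step W i s (.enterCollect t) { s with pc := .call (.remove i t) }
  -- `apply(up)` for an update `up`
  | rbroadcast (s : LState W) (a : W.Sigma) (hpc : s.pc = .call a)
      (hadm : Admissible W i s.seq a) :
      Step W i s (.rbroadcast (s.sn + 1) a) { s with sn := s.sn + 1, pc := .wait a }
  | abort (s : LState W) (up : Op n T V) (hpc : s.pc = .call up)
      (hadm : ¬ ∃ a : W.Sigma, (a : Op n T V) = up ∧ Admissible W i s.seq a) :
      Step W i s .abort { s with pc := .aborted }
  | applyReturn (s : LState W) (up : Op n T V) (hpc : s.pc = .wait up) (hdel : s.del i = s.sn) :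
      Step W i s (.applyReturn up) { s with pc := afterApply up s.out }
  -- the other statements of the client
  | readTop_some (s : LState W) (j : Fin n) (t : T) (hpc : s.pc = .steal j)
      (ht : W.getTop j (W.trace s.seq) = some t) :
      Step W i s .readTop { s with pc := .execRemote t }
  | readTop_none (s : LState W) (j : Fin n) (hpc : s.pc = .steal j)
      (ht : W.getTop j (W.trace s.seq) = none) :
      Step W i s .readTop { s with pc := .idle }
  | execute_local (s : LState W) (t : T) (r : V) (hpc : s.pc = .execLocal t)
      (hr : W.Valid t r) :
      Step W i s (.execute t r) { s with pc := .publish t r }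
  | execute_remote (s : LState W) (t : T) (r : V) (hpc : s.pc = .execRemote t)
      (hr : W.Valid t r) :
      Step W i s (.execute t r) { s with pc := .call (.addResult t r) }
  | choose (s : LState W) (t : T) (r : V) (hpc : s.pc = .choose t)
      (hr : r ∈ W.getResults t (W.trace s.seq)) :
      Step W i s (.choose t r) { s with pc := .publish t r }
  | publish (s : LState W) (t : T) (r : V) (hpc : s.pc = .publish t r) :
      Step W i s (.publish t r) { s with pc := .idle }

/-! ### Executions of the distributed system -/

/-- The two failure models. -/
inductive FaultModel
  | crash
  | byzantine

/-- An (interleaved) execution: the local states at every time, and the event, if any, that leads from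
time `k` to time `k + 1`, together with the process at which it occurs. -/
structure Execution (W : App n T V) where
  state : ℕ → Fin n → LState W
  event : ℕ → Option (Fin n × Event n T V)

/-- The event `e` occurs at process `i` at time `k`. -/
def Execution.At {W : App n T V} (E : Execution W) (k : ℕ) (i : Fin n) (e : Event n T V) : Prop :=
  E.event k = some (i, e)

/-- The processes that follow their code (until they crash, if they do): all of them in the crash
model, the correct ones in the Byzantine model. -/
def FollowsCode (m : FaultModel) (faulty : Finset (Fin n)) (i : Fin n) : Prop :=
  match m with
  | .crash => True
  | .byzantine => i ∉ faulty

/-- The reliable broadcast abstraction: CR-Broadcast in the crash model and BR-Broadcast in the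
Byzantine model, where the requirements are restricted to correct processes. -/
structure ReliableBroadcast {W : App n T V} (m : FaultModel) (faulty : Finset (Fin n))
    (E : Execution W) : Prop where
  validity : ∀ i j, FollowsCode m faulty i → FollowsCode m faulty j → ∀ k sn up,
    E.At k i (.rdeliver j sn up) → ∃ k' < k, E.At k' j (.rbroadcast sn up)
  integrity : ∀ i, FollowsCode m faulty i → ∀ j k k' sn up up',
    E.At k i (.rdeliver j sn up) → E.At k' i (.rdeliver j sn up') → k = k'
  termination₁ : ∀ i, i ∉ faulty → ∀ k sn up,
    E.At k i (.rbroadcast sn up) → ∃ k', E.At k' i (.rdeliver i sn up)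
  termination₂ : ∀ i, FollowsCode m faulty i → ∀ j k sn up,
    E.At k i (.rdeliver j sn up) → ∀ l, l ∉ faulty → ∃ k', E.At k' l (.rdeliver j sn up)

/-- The monitor of process `i` is free at arbitrarily late times. -/
def Execution.FreeInfOften {W : App n T V} (E : Execution W) (i : Fin n) : Prop :=
  ∀ K, ∃ k ≥ K, (E.state k i).pc = .idle

/-- Scheduling assumptions on a correct process `i`. The assumption on a block of the client that
waits for the monitor is only made if the monitor is free infinitely often. -/
structure Fair {W : App n T V} (E : Execution W) (i : Fin n) : Prop where
  /-- A statement of the block in the monitor that stays enabled is eventually executed; in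
  particular every `execute(t)` ends. -/
  inBlock : ∀ K, (∀ k ≥ K, ∃ e s', e.InBlock ∧ Step W i (E.state k i) e s') →
    ∃ k ≥ K, ∃ e, e.InBlock ∧ E.At k i e
  /-- An r-delivered update whose waiting condition stays true is eventually processed. -/
  process : ∀ K j sn up,
    (∀ k ≥ K, ∃ s', Step W i (E.state k i) (.process j sn up) s') →
    ∃ k ≥ K, E.At k i (.process j sn up)
  submit : ∀ K t, E.FreeInfOften i → (∀ k ≥ K, t ∈ (E.state k i).pending) →
    ∃ k ≥ K, E.At k i (.enterSubmit t)
  localTask : ∀ K, E.FreeInfOften i → (∀ k ≥ K, GuardLocal W i (E.state k i)) →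
    ∃ k ≥ K, E.At k i .enterLocal
  steal : ∀ K, E.FreeInfOften i → (∀ k ≥ K, ∃ j, GuardSteal W i j (E.state k i)) →
    ∃ k ≥ K, ∃ j, E.At k i (.enterSteal j)
  collect : ∀ K, E.FreeInfOften i → (∀ k ≥ K, ∃ t, GuardCollect W i t (E.state k i)) →
    ∃ k ≥ K, ∃ t, E.At k i (.enterCollect t)

/-- `E` is an execution of the work stealing algorithm in the crash or Byzantine asynchronous message
passing model, with `f < n` the maximal number of faulty processes and `faulty` the set of the
faulty ones. Nothing is required of a Byzantine process. -/
structure IsExecution {W : App n T V} (m : FaultModel) (f : ℕ) (faulty : Finset (Fin n))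
    (E : Execution W) : Prop where
  resilience : f < n
  card_faulty : faulty.card ≤ f
  init : ∀ i, FollowsCode m faulty i → E.state 0 i = LState.init W
  step : ∀ i, FollowsCode m faulty i → ∀ k e, E.At k i e →
    Step W i (E.state k i) e (E.state (k + 1) i)
  noStep : ∀ i, FollowsCode m faulty i → ∀ k, (∀ e, ¬ E.At k i e) →
    E.state (k + 1) i = E.state k i
  /-- In the crash model, a faulty process stops at some time. -/
  crash : m = .crash → ∀ i ∈ faulty, ∃ K, ∀ k ≥ K, ∀ e, ¬ E.At k i e
  broadcast : ReliableBroadcast m faulty E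
  fair : ∀ i, i ∉ faulty → Fair E i

/-- At some time strictly between `k` and `k'` a process that follows its code has executed `t`; or,
in the Byzantine model, where the computations of a faulty process cannot be observed, before time
`k'` process `i` has processed a valid result for `t` that a Byzantine process has published. -/
def ExecutedBetween {W : App n T V} (m : FaultModel) (faulty : Finset (Fin n)) (E : Execution W)
    (i : Fin n) (t : T) (k k' : ℕ) : Prop :=
  (∃ l, FollowsCode m faulty l ∧ ∃ k'' r, k < k'' ∧ k'' < k' ∧ E.At k'' l (.execute t r)) ∨
  (m = .byzantine ∧ ∃ l ∈ faulty, ∃ k'' sn r, k'' < k' ∧ W.Valid t r ∧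
    E.At k'' i (.process l sn (.addResult t r)))

end WorkStealing

namespace WorkStealing

universe u v

variable {n : ℕ} {T : Type u} {V : Type v} {W : App n T V}

/-! ### Traces of words -/

/-! Follow one task `t` of the correct process `i`. Once submitted, it is in exactly one place: in a
submission under way, in the deque, between deque and publication, or published. Two conservation
laws, the fields `submitted` and `pushed` of `Inv`, express this: invocations = submissions under
way + pushes in `seq`, and pushes in `seq` = copies in the deque + publications under way +
publications made. Every step respects them (`LInv.submitting_step`, `LInv.stored_step`). Since `t`
is invoked at most once, every summand is at most 1, which gives uniqueness of the publication.

The laws require that `i` never aborts and processes an own update only while its client waits for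
it (`Regular`). The first holds because only updates of `i` change the deque of `i` and results are
never withdrawn: a guard that was true on entering a block is still true when the update is tested,
and a repeated push is excluded by the first law. The second holds because everything `i` delivers
from itself was broadcast by `i`, one number at a time. `Inv` and `Regular` are therefore proved by
a joint induction on time.

For existence, the rank of the program position drops until the monitor is free; termination of the
broadcast ends each wait (`IsExecution.freeInfOften`). Fairness then gets `t` pushed, and it cannot
stay in the deque, since each entry of the local handler lowers `distance`. At a later free moment
nothing is under way, so the laws leave only one place for `t`: it has been published.

A published result was computed by `i` itself or read from `getResults`. In the latter case it is
traced back through processing, delivery and broadcast to an `execute(t)`, and from there through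
the push that the thief had seen to the submission. The chain breaks only at a Byzantine publisher.
-/

theorem App.trace_concat (w : List W.Sigma) (a : W.Sigma) :
    W.trace (w ++ [a]) = W.trace w * W.letter a := rfl

theorem App.trace_nil : W.trace [] = 1 := rfl

open Classical in
theorem App.count_mul_letter (a b : W.Sigma) (v : W.Trace) :
    W.count a (v * W.letter b) = W.count a v + if b = a then 1 else 0 := by
  simp only [App.count, map_mul, toAdd_mul]
  rfl

theorem App.count_one (a : W.Sigma) : W.count a 1 = 0 := by
  simp [App.count]

theorem App.count_pos_iff (a : W.Sigma) (w : List W.Sigma) :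
    0 < W.count a (W.trace w) ↔ a ∈ w := by
  induction w using List.reverseRecOn with
  | nil => simp [App.trace_nil, App.count_one]
  | append_singleton w b ih =>
    rw [App.trace_concat, App.count_mul_letter, List.mem_append, ← ih, List.mem_singleton]
    split_ifs with h
    · simp [h]
    · simp [Ne.symm h]

theorem App.one_mem_L : (1 : W.Trace) ∈ W.L :=
  ⟨fun a _ _ _ => by simp [App.count_one], fun i => by simp [App.dState_one]⟩

theorem App.getResults_trace (t : T) (w : List W.Sigma) (r : V) :
    r ∈ W.getResults t (W.trace w) ↔ ∃ a ∈ w, (a : Op n T V) = .addResult t r := by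
  simp only [App.getResults, Set.mem_ofPred_eq, App.count_pos_iff]
  exact ⟨fun ⟨a, h, h'⟩ => ⟨a, h', h⟩, fun ⟨a, h, h'⟩ => ⟨a, h', h⟩⟩

theorem App.getResults_concat_nonempty {t : T} {w : List W.Sigma} (a : W.Sigma)
    (h : (W.getResults t (W.trace w)).Nonempty) :
    (W.getResults t (W.trace (w ++ [a]))).Nonempty := by
  obtain ⟨r, hr⟩ := h
  obtain ⟨b, hb, hbr⟩ := (App.getResults_trace t w r).1 hr
  exact ⟨r, (App.getResults_trace t _ r).2 ⟨b, List.mem_append_left _ hb, hbr⟩⟩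

/-! ### The alphabet -/

theorem App.notMem_O_of_mem_C {a : Op n T V} (h : a ∈ W.C) (i : Fin n) : a ∉ W.O i := by
  obtain ⟨t, r, _, rfl⟩ := h
  rintro (⟨t, _, h | h⟩ | h) <;> cases h

theorem App.eq_of_mem_O {a : Op n T V} {i j : Fin n} (hi : a ∈ W.O i) (hj : a ∈ W.O j) :
    i = j := by
  rcases hi with ⟨t, _, rfl | rfl⟩ | rfl <;> rcases hj with ⟨t, _, h | h⟩ | h <;> cases h <;> rfl

theorem App.notMem_O_of_ne {a : Op n T V} {i j : Fin n} (ha : a ∈ W.C ∪ W.O j) (hij : j ≠ i) :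
    a ∉ W.O i := by
  rcases ha with ha | ha
  · exact App.notMem_O_of_mem_C ha i
  · exact fun h => hij (App.eq_of_mem_O ha h)

theorem App.valid_of_mem {t : T} {r : V} (h : (.addResult t r : Op n T V) ∈ W.Sigma) :
    W.Valid t r := by
  rcases h with ⟨t', r', hv, h⟩ | h
  · cases h; exact hv
  · obtain ⟨i, ⟨t, _, h | h⟩ | h⟩ := Set.mem_iUnion.1 h <;> cases h

theorem App.pushBottom_mem_O {i j : Fin n} {t : T} (h : (.pushBottom j t : Op n T V) ∈ W.O i) :
    j = i ∧ W.owner t = i := by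
  rcases h with ⟨t', ht, h | h⟩ | h <;> cases h
  exact ⟨rfl, ht⟩

theorem App.pushBottom_mem {j : Fin n} {t : T} (h : (.pushBottom j t : Op n T V) ∈ W.Sigma) :
    W.owner t = j := by
  rcases h with ⟨t', r', hv, h⟩ | h
  · cases h
  · obtain ⟨i, hi⟩ := Set.mem_iUnion.1 h
    obtain ⟨rfl, h⟩ := App.pushBottom_mem_O hi
    exact h

theorem App.pushBottom_mem_C_union_O {i j : Fin n} {t : T}
    (h : (.pushBottom j t : Op n T V) ∈ W.C ∪ W.O i) : j = i ∧ W.owner t = i := by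
  rcases h with ⟨t', r', hv, h⟩ | h
  · cases h
  · exact App.pushBottom_mem_O h

theorem App.mem_Sigma_of_mem {a : Op n T V} {i : Fin n} (h : a ∈ W.C ∪ W.O i) : a ∈ W.Sigma := by
  rcases h with h | h
  · exact Or.inl h
  · exact Or.inr (Set.mem_iUnion.2 ⟨i, h⟩)

/-- The letter `pushBottom_{i,t}`. -/
def App.pushLetter (W : App n T V) {i : Fin n} {t : T} (h : W.owner t = i) : W.Sigma :=
  ⟨.pushBottom i t, Or.inr (Set.mem_iUnion.2 ⟨i, Or.inl ⟨t, h, Or.inl rfl⟩⟩)⟩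

/-! ### The content of a deque -/

theorem App.dState_concat (i : Fin n) (w : List W.Sigma) (a : W.Sigma) :
    W.dState i (W.trace (w ++ [a])) = act i (a : Op n T V) (W.dState i (W.trace w)) := by
  rw [App.trace_concat, App.dState_mul_letter]

theorem mem_of_mem_act {i : Fin n} {t : T} {a : Op n T V} {o : Option (List T)} {q : List T}
    (hq : act i a o = some q) (ht : t ∈ q) : (∃ p, o = some p ∧ t ∈ p) ∨ a = .pushBottom i t := by
  cases o with
  | none => cases a <;> simp [act] at hq
  | some p =>
    cases a with
    | pushBottom j t' =>
      simp only [act] at hq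
      split_ifs at hq with hj
      · cases hq
        subst hj
        rcases List.mem_append.1 ht with h | h
        · exact Or.inl ⟨p, rfl, h⟩
        · rw [List.mem_singleton] at h
          exact Or.inr (by rw [h])
      · cases hq
        exact Or.inl ⟨_, rfl, ht⟩
    | popBottom j =>
      simp only [act] at hq
      split_ifs at hq with hj
      · cases p with
        | nil => simp at hq
        | cons x p =>
          cases hq
          exact Or.inl ⟨_, rfl, List.mem_cons_of_mem _ ht⟩
      · cases hq
        exact Or.inl ⟨_, rfl, ht⟩
    | remove j t' =>
      simp only [act] at hq
      split_ifs at hq with hj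
      · cases hq
        exact Or.inl ⟨p, rfl, List.mem_of_mem_filter ht⟩
      · cases hq
        exact Or.inl ⟨_, rfl, ht⟩
    | addResult t' r =>
      cases hq
      exact Or.inl ⟨_, rfl, ht⟩

/-- By induction on the word, since no letter but the push inserts an element. It traces a task seen
by a thief back to its owner. -/
theorem App.exists_pushBottom_of_mem {j : Fin n} {t : T} (w : List W.Sigma) :
    ∀ {q : List T}, W.dState j (W.trace w) = some q → t ∈ q →
      ∃ a ∈ w, (a : Op n T V) = .pushBottom j t := by
  induction w using List.reverseRecOn with
  | nil =>
    intro q hq ht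
    rw [App.trace_nil, App.dState_one] at hq
    cases hq
    simp at ht
  | append_singleton w b ih =>
    intro q hq ht
    rw [App.dState_concat] at hq
    rcases mem_of_mem_act hq ht with ⟨p, hp, htp⟩ | hb
    · obtain ⟨a, ha, h⟩ := ih hp htp
      exact ⟨a, List.mem_append_left _ ha, h⟩
    · exact ⟨b, by simp, hb⟩

theorem App.owner_of_mem {j : Fin n} {t : T} {w : List W.Sigma} {q : List T}
    (hq : W.dState j (W.trace w) = some q) (ht : t ∈ q) : W.owner t = j := by
  obtain ⟨a, _, ha⟩ := App.exists_pushBottom_of_mem w hq ht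
  exact App.pushBottom_mem (ha ▸ a.2)

/-- A letter of `C ∪ O_i` acts on no deque but that of `i`, so `L` can be left only through this
deque or by repeating a push. -/
theorem Admissible.of_act {i : Fin n} {w : List W.Sigma} {a : W.Sigma} (hw : W.trace w ∈ W.L)
    (ha : (a : Op n T V) ∈ W.C ∪ W.O i)
    (hact : act i (a : Op n T V) (W.dState i (W.trace w)) ≠ none)
    (hpush : ∀ j t, (a : Op n T V) = .pushBottom j t → a ∉ w) : Admissible W i w a := by
  refine ⟨ha, fun b j t hb => ?_, fun j => ?_⟩
  · rw [App.trace_concat, App.count_mul_letter]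
    split_ifs with h
    · subst h
      have := hpush j t hb
      rw [← App.count_pos_iff] at this
      omega
    · exact hw.1 b j t hb
  · rw [App.dState_concat]
    by_cases hij : i = j
    · subst hij; exact hact
    · rw [act_eq_self W j a (App.notMem_O_of_ne ha hij)]
      exact hw.2 j

/-- The indicator of a proposition, as a natural number. -/
noncomputable def ind (p : Prop) : ℕ := open Classical in if p then 1 else 0

/-- The decidability instance is arbitrary: conditionals produced by different counting functions
become atoms of one form for `omega`. -/
theorem ite_eq_ind (p : Prop) [Decidable p] : (if p then 1 else 0) = ind p := by
  unfold ind
  congr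

@[simp]
theorem ind_true : ind True = 1 := by simp [ind]

@[simp]
theorem ind_false : ind False = 0 := by simp [ind]

/-! ### Local invariants of a process that follows its code -/

/-- The content of the deque of process `i` in the local state `s`. -/
noncomputable def LState.deque (i : Fin n) (s : LState W) : List T :=
  (W.dState i (W.trace s.seq)).getD []

/-- The update `up` of process `i` has been called but not yet processed by `i` itself. -/
def Prep (i : Fin n) (s : LState W) (up : Op n T V) : Prop :=
  s.pc = .call up ∨ s.pc = .wait up ∧ s.sn = s.del i + 1

/-- The task `t` has left the deque of process `i`, and its publication is on its way. -/
def Post (i : Fin n) (s : LState W) (t : T) : Prop :=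
  (s.del i = s.sn ∧ (s.pc = .wait (.popBottom i) ∧ s.out = some t ∨ s.pc = .wait (.remove i t))) ∨
    s.pc = .execLocal t ∨ s.pc = .choose t ∨ ∃ r, s.pc = .publish t r

/-- What is known about an update that the client of process `i` has called. -/
def Callable (i : Fin n) (s : LState W) : Op n T V → Prop
  | .pushBottom j t => j = i ∧ W.owner t = i
  | .popBottom j => j = i ∧ GuardLocal W i s
  | .remove j t => j = i ∧ GuardCollect W i t s
  | .addResult t r => W.Valid t r

/-- What is known about an update of process `i` that `i` has processed and that has not yet
returned. -/
def Returnable (i : Fin n) (s : LState W) : Op n T V → Prop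
  | .pushBottom _ _ => True
  | .popBottom j => j = i ∧ ∃ t, s.out = some t
  | .remove j t => j = i ∧ (W.getResults t (W.trace s.seq)).Nonempty
  | .addResult _ _ => True

/-- The part of the local invariant that depends on the position in the code. -/
def PCInv (i : Fin n) (s : LState W) : Prop :=
  match s.pc with
  | .call up => s.del i = s.sn ∧ Callable i s up
  | .wait up => (s.sn = s.del i + 1 ∧ Callable i s up) ∨ (s.del i = s.sn ∧ Returnable i s up)
  | .choose t => s.del i = s.sn ∧ (W.getResults t (W.trace s.seq)).Nonempty
  | .aborted => False
  | _ => s.del i = s.sn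

/-- The local invariant. -/
structure LInv (i : Fin n) (s : LState W) : Prop where
  mem_L : W.trace s.seq ∈ W.L
  owner_of_pending : ∀ t ∈ s.pending, W.owner t = i
  pcInv : PCInv i s

theorem LState.dState_eq {s : LState W} (h : W.trace s.seq ∈ W.L) (i : Fin n) :
    W.dState i (W.trace s.seq) = some (s.deque i) := by
  unfold LState.deque
  cases hd : W.dState i (W.trace s.seq) with
  | none => exact absurd hd (h.2 i)
  | some q => rfl

theorem LState.guardLocal_iff {s : LState W} (h : W.trace s.seq ∈ W.L) (i : Fin n) :
    GuardLocal W i s ↔ s.deque i ≠ [] := by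
  simp [GuardLocal, App.getBottom, LState.dState_eq h]

theorem LState.mem_getPending_iff {s : LState W} (h : W.trace s.seq ∈ W.L) (i : Fin n) (t : T) :
    t ∈ W.getPending i (W.trace s.seq) ↔ t ∈ s.deque i := by
  simp [App.getPending, LState.dState_eq h]

theorem LState.owner_of_mem_deque {s : LState W} (h : W.trace s.seq ∈ W.L) {i : Fin n} {t : T}
    (ht : t ∈ s.deque i) : W.owner t = i :=
  App.owner_of_mem (LState.dState_eq h i) ht

theorem LInv.init (i : Fin n) : LInv i (LState.init W) where
  mem_L := by
    change W.trace [] ∈ _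
    rw [App.trace_nil]
    exact App.one_mem_L
  owner_of_pending := by simp [LState.init]
  pcInv := rfl

theorem PC.idle_del {i : Fin n} {s : LState W} (h : LInv i s) (hpc : s.pc = .idle) :
    s.del i = s.sn := by
  have := h.pcInv
  simpa only [PCInv, hpc] using this

/-- Used for updates of other processes, which leave the deque of `i` alone and can only add
results: the guard of a block survives until its update is processed. -/
theorem Callable.congr {i : Fin n} {s s' : LState W} {up : Op n T V}
    (hd : W.dState i (W.trace s'.seq) = W.dState i (W.trace s.seq))
    (hr : ∀ t, (W.getResults t (W.trace s.seq)).Nonempty →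
      (W.getResults t (W.trace s'.seq)).Nonempty)
    (h : Callable i s up) : Callable i s' up := by
  cases up with
  | pushBottom j t => exact h
  | popBottom j =>
    refine ⟨h.1, ?_⟩
    have := h.2
    simp only [GuardLocal, App.getBottom] at this ⊢
    rwa [hd]
  | remove j t =>
    refine ⟨h.1, ?_, hr _ h.2.2⟩
    have := h.2.1
    simp only [App.getPending] at this ⊢
    rwa [hd]
  | addResult t r => exact h

theorem Returnable.congr {i : Fin n} {s s' : LState W} {up : Op n T V}
    (ho : s'.out = s.out)
    (hr : ∀ t, (W.getResults t (W.trace s.seq)).Nonempty →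
      (W.getResults t (W.trace s'.seq)).Nonempty)
    (h : Returnable i s up) : Returnable i s' up := by
  cases up with
  | pushBottom j t => exact h
  | popBottom j => exact ⟨h.1, by rw [ho]; exact h.2⟩
  | remove j t => exact ⟨h.1, hr _ h.2⟩
  | addResult t r => exact h

theorem PCInv.congr {i : Fin n} {s s' : LState W} (hpc : s'.pc = s.pc) (hsn : s'.sn = s.sn)
    (hdel : s'.del i = s.del i) (ho : s'.out = s.out)
    (hd : W.dState i (W.trace s'.seq) = W.dState i (W.trace s.seq))
    (hr : ∀ t, (W.getResults t (W.trace s.seq)).Nonempty →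
      (W.getResults t (W.trace s'.seq)).Nonempty)
    (h : PCInv i s) : PCInv i s' := by
  unfold PCInv at h ⊢
  rw [hpc, hsn, hdel]
  cases hc : s.pc with
  | call up => rw [hc] at h; exact ⟨h.1, h.2.congr hd hr⟩
  | wait up =>
    rw [hc] at h
    exact h.imp (fun h => ⟨h.1, h.2.congr hd hr⟩) (fun h => ⟨h.1, h.2.congr ho hr⟩)
  | choose t => rw [hc] at h; exact ⟨h.1, hr _ h.2⟩
  | _ => rw [hc] at h; exact h

theorem Admissible.dState_of_ne {i j : Fin n} {w : List W.Sigma} {a : W.Sigma}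
    (h : Admissible W j w a) (hij : j ≠ i) :
    W.dState i (W.trace (w ++ [a])) = W.dState i (W.trace w) := by
  rw [App.dState_concat, act_eq_self W i a (App.notMem_O_of_ne h.1 hij)]

/-- A step of `i` processes only updates of `i` for which the client is waiting, and is no abort. -/
structure Regular (i : Fin n) (s : LState W) (e : Event n T V) : Prop where
  process : ∀ sn up, e = .process i sn up → s.pc = .wait up ∧ s.sn = s.del i + 1
  abort : e ≠ .abort
  invoke : ∀ t, e = .invoke t → W.owner t = i

/-- The delicate step is the processing of an own update, where the guard kept in `Callable` becomes
the promise `Returnable` about the answer. In particular a popped deque was nonempty, so the client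
does not end in `.aborted`. -/
theorem LInv.step {i : Fin n} {s s' : LState W} {e : Event n T V} (h : LInv i s)
    (hst : Step W i s e s') (hreg : Regular i s e) : LInv i s' := by
  have hpcI := h.pcInv
  cases hst with
  | invoke t =>
    refine ⟨h.mem_L, fun t' ht' => ?_, hpcI⟩
    rcases Multiset.mem_cons.1 ht' with rfl | ht'
    · exact hreg.invoke _ rfl
    · exact h.owner_of_pending _ ht'
  | rdeliver j sn up =>
    exact ⟨h.mem_L, h.owner_of_pending, hpcI.congr rfl rfl rfl rfl rfl (fun _ h => h)⟩
  | process j sn a hbuf hsn hadm =>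
    refine ⟨hadm.2, h.owner_of_pending, ?_⟩
    by_cases hj : j = i
    · subst hj
      obtain ⟨hw, hd⟩ := hreg.process _ _ rfl
      unfold PCInv at hpcI ⊢
      simp only [hw, Function.update_self] at hpcI ⊢
      rcases hpcI with ⟨_, hc⟩ | ⟨h', _⟩
      · refine Or.inr ⟨by omega, ?_⟩
        cases hup : (a : Op n T V) with
        | pushBottom l t => trivial
        | popBottom l =>
          rw [hup] at hc
          obtain ⟨rfl, hg⟩ := hc
          refine ⟨rfl, ?_⟩
          simp only [if_true, App.output]
          exact Option.ne_none_iff_exists'.1 hg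
        | remove l t =>
          rw [hup] at hc
          exact ⟨hc.1, App.getResults_concat_nonempty a hc.2.2⟩
        | addResult t r => trivial
      · omega
    · refine PCInv.congr (s := s) rfl rfl ?_ ?_ (hadm.dState_of_ne hj)
        (fun t => App.getResults_concat_nonempty a) hpcI
      · simp [Function.update_of_ne (Ne.symm hj)]
      · simp [hj]
  | enterSubmit t p hpc hp =>
    have := PC.idle_del h hpc
    refine ⟨h.mem_L, fun t' ht' => h.owner_of_pending _ ?_, this, rfl, h.owner_of_pending _ ?_⟩
    · rw [hp]; exact Multiset.mem_cons_of_mem ht'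
    · rw [hp]; exact Multiset.mem_cons_self _ _
  | enterLocal hpc hg =>
    have := PC.idle_del h hpc
    exact ⟨h.mem_L, h.owner_of_pending, this, rfl, hg⟩
  | enterSteal j hpc hg =>
    have := PC.idle_del h hpc
    exact ⟨h.mem_L, h.owner_of_pending, this⟩
  | enterCollect t hpc hg =>
    have := PC.idle_del h hpc
    exact ⟨h.mem_L, h.owner_of_pending, this, rfl, hg⟩
  | rbroadcast a hpc hadm =>
    unfold PCInv at hpcI
    simp only [hpc] at hpcI
    exact ⟨h.mem_L, h.owner_of_pending, Or.inl ⟨by simp [hpcI.1],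
      hpcI.2.congr rfl (fun _ h => h)⟩⟩
  | abort => exact absurd rfl hreg.abort
  | applyReturn up hpc hdel =>
    refine ⟨h.mem_L, h.owner_of_pending, ?_⟩
    unfold PCInv at hpcI ⊢
    simp only [hpc] at hpcI ⊢
    rcases hpcI with ⟨h', _⟩ | ⟨_, hr⟩
    · omega
    · cases up with
      | popBottom j =>
        obtain ⟨_, t, ht⟩ := hr
        rw [ht]
        exact hdel
      | remove j t => exact ⟨hdel, hr.2⟩
      | _ => exact hdel
  | _ =>
    refine ⟨h.mem_L, h.owner_of_pending, ?_⟩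
    unfold PCInv at hpcI ⊢
    simp_all [Callable]

/-! ### The whereabouts of a task -/

open Classical in
/-- The number of pending or running submissions of `t` at process `i`. -/
noncomputable def submitting (i : Fin n) (t : T) (s : LState W) : ℕ :=
  s.pending.count t + ind (Prep i s (.pushBottom i t))

open Classical in
/-- The number of copies of `t` in the deque of `i`. -/
noncomputable def stored (i : Fin n) (t : T) (s : LState W) : ℕ := (s.deque i).count t

/-- The number of publications of `t` that are on their way. -/
noncomputable def publishing (i : Fin n) (t : T) (s : LState W) : ℕ := ind (Post i s t)

open Classical in
theorem LInv.submitting_step {i : Fin n} {s s' : LState W} {e : Event n T V} (h : LInv i s)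
    (hst : Step W i s e s') (hreg : Regular i s e) {t : T} (ht : W.owner t = i) :
    submitting i t s' + W.count (W.pushLetter ht) (W.trace s'.seq) =
      submitting i t s + W.count (W.pushLetter ht) (W.trace s.seq) +
        ind (e = .invoke t) := by
  have hpcI := h.pcInv
  unfold PCInv at hpcI
  cases hst with
  | invoke t' =>
    simp only [submitting, Prep, Multiset.count_cons, ite_eq_ind, Event.invoke.injEq, eq_comm (a := t)]
    omega
  | rdeliver j sn up => simp [submitting, Prep]
  | process j sn a hbuf hsn hadm =>
    simp only [submitting, Prep, App.trace_concat, App.count_mul_letter, ite_eq_ind]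
    by_cases hj : j = i
    · subst hj
      obtain ⟨hw, hd⟩ := hreg.process _ _ rfl
      simp only [hw, Function.update_self, hd, hsn]
      have : (a : Op n T V) = .pushBottom j t ↔ a = W.pushLetter ht := by
        rw [Subtype.ext_iff]; rfl
      simp [this]
      omega
    · have hne : a ≠ W.pushLetter ht := by
        rintro rfl
        exact hj (App.pushBottom_mem_C_union_O hadm.1).1.symm
      simp [hne, Function.update_of_ne (Ne.symm hj)]
  | enterSubmit t' p hpc hp =>
    simp only [submitting, Prep, hpc, hp, Multiset.count_cons, ite_eq_ind]
    simp [eq_comm (a := t)]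
  | rbroadcast a hpc hadm =>
    simp only [hpc] at hpcI
    simp [submitting, Prep, hpc, hpcI.1]
  | abort => exact absurd rfl hreg.abort
  | applyReturn up hpc hdel =>
    have : ∀ up', afterApply up s.out ≠ .call up' ∧ afterApply up s.out ≠ .wait up' := by
      intro up'
      cases up <;> cases s.out <;> simp [afterApply]
    simp [submitting, Prep, hpc, hdel, this]
  | _ => simp_all [submitting, Prep]

-- A push feeds the deque, `popBottom` and `remove` turn a stored copy into a publication under way,
-- and `publish` completes it. The bound `hle` serves `remove`, which deletes all copies but starts
-- a single publication.
open Classical in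
theorem LInv.stored_step {i : Fin n} {s s' : LState W} {e : Event n T V} (h : LInv i s)
    (hst : Step W i s e s') (hreg : Regular i s e) {t : T} (ht : W.owner t = i)
    (hle : stored i t s ≤ 1) :
    W.count (W.pushLetter ht) (W.trace s'.seq) + (stored i t s + publishing i t s) =
      W.count (W.pushLetter ht) (W.trace s.seq) + (stored i t s' + publishing i t s') +
        ind (∃ r, e = .publish t r) := by
  have hpcI := h.pcInv
  unfold PCInv at hpcI
  cases hst with
  | process j sn a hbuf hsn hadm =>
    by_cases hj : j = i
    · subst hj
      obtain ⟨hw, hd⟩ := hreg.process _ _ rfl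
      simp only [hw] at hpcI
      rcases hpcI with ⟨_, hc⟩ | ⟨h', _⟩
      swap
      · omega
      have hlet : a = W.pushLetter ht ↔ (a : Op n T V) = .pushBottom j t := by
        rw [Subtype.ext_iff]; rfl
      have hq := LState.dState_eq h.mem_L j
      obtain ⟨q, hdq⟩ : ∃ q, s.deque j = q := ⟨_, rfl⟩
      rw [hdq] at hq
      simp only [stored, publishing, LState.deque, App.trace_concat, App.count_mul_letter, ite_eq_ind,
        App.dState_mul_letter, Post, hw, hlet, Function.update_self, App.output, hq, hd,
        hsn] at hle ⊢
      cases hup : (a : Op n T V) with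
      | pushBottom l t' =>
        rw [hup] at hc
        obtain ⟨rfl, _⟩ := hc
        simp [act, List.count_append, List.count_singleton, ite_eq_ind]
        omega
      | popBottom l =>
        rw [hup] at hc
        obtain ⟨rfl, hg⟩ := hc
        rw [LState.guardLocal_iff h.mem_L, hdq] at hg
        obtain ⟨x, q, rfl⟩ := List.exists_cons_of_ne_nil hg
        -- The old head `x` becomes `out`, so `Post` now holds for `x` exactly as the deque loses
        -- it.
        simp [act, hq, List.count_cons, ite_eq_ind]
      | remove l t' =>
        rw [hup] at hc
        obtain ⟨rfl, hg⟩ := hc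
        have hmem := hdq ▸ (LState.mem_getPending_iff h.mem_L l t').1 hg.1
        by_cases htt : t' = t
        · subst htt
          have h1 := List.count_pos_iff.2 hmem
          simp only [Option.getD_some] at hle
          have h0 : List.count t' (q.filter (fun x => x ≠ t')) = 0 := by
            rw [List.count_eq_zero]
            simp
          simp [act] at h0 ⊢
          omega
        · have h0 : List.count t (q.filter (fun x => x ≠ t')) =
              List.count t q := List.count_filter (by simpa using Ne.symm htt)
          simp [act, htt] at h0 ⊢
          exact h0.symm
      | addResult t' r => simp [act]
    · have hne : a ≠ W.pushLetter ht := by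
        rintro rfl
        exact hj (App.pushBottom_mem_C_union_O hadm.1).1.symm
      have hd := hadm.dState_of_ne hj
      simp [stored, publishing, LState.deque, hd, Post, App.trace_concat, App.count_mul_letter,
        Function.update_of_ne (Ne.symm hj), hj, hne] at hd ⊢
  | rbroadcast a hpc hadm =>
    simp only [hpc] at hpcI
    simp [stored, publishing, LState.deque, Post, hpc, hpcI.1]
  | abort => exact absurd rfl hreg.abort
  | applyReturn up hpc hdel =>
    simp only [hpc] at hpcI
    rcases hpcI with ⟨h', _⟩ | ⟨_, hr⟩
    · omega
    cases up with
    | popBottom j =>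
      obtain ⟨rfl, t', ht'⟩ := hr
      simp [stored, publishing, LState.deque, Post, hpc, hdel, afterApply, ht']
    | remove j t' =>
      obtain ⟨rfl, _⟩ := hr
      simp [stored, publishing, LState.deque, Post, hpc, hdel, afterApply]
    | _ => simp [stored, publishing, LState.deque, Post, hpc, hdel, afterApply]
  | publish t' r hpc => simp [stored, publishing, LState.deque, Post, hpc, add_assoc]
  | _ => simp_all [stored, publishing, LState.deque, Post]

/-- Serves twice: the test of `apply` never fails, and an own update that has been delivered can be
processed. The guard makes the action on the deque defined; freshness of a push is left to the
caller, as it depends on the global count. -/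
theorem LInv.exists_admissible {i : Fin n} {s : LState W} (h : LInv i s) {up : Op n T V}
    (hc : Callable i s up)
    (hpush : ∀ t, up = .pushBottom i t → ∀ ht : W.owner t = i, W.pushLetter ht ∉ s.seq) :
    ∃ a : W.Sigma, (a : Op n T V) = up ∧ Admissible W i s.seq a := by
  have hd := LState.dState_eq h.mem_L i
  have hO : up ∈ W.C ∪ W.O i := by
    cases up with
    | pushBottom j t => obtain ⟨rfl, ht⟩ := hc; exact Or.inr (Or.inl ⟨t, ht, Or.inl rfl⟩)
    | popBottom j => obtain ⟨rfl, _⟩ := hc; exact Or.inr (Or.inr rfl)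
    | remove j t =>
      obtain ⟨rfl, hg⟩ := hc
      exact Or.inr (Or.inl ⟨t, LState.owner_of_mem_deque h.mem_L
        ((LState.mem_getPending_iff h.mem_L _ t).1 hg.1), Or.inr rfl⟩)
    | addResult t r => exact Or.inl ⟨t, r, hc, rfl⟩
  refine ⟨⟨up, App.mem_Sigma_of_mem hO⟩, rfl, Admissible.of_act h.mem_L hO ?_ ?_⟩
  · rw [hd]
    cases up with
    | pushBottom j t => obtain ⟨rfl, ht⟩ := hc; simp [act]
    | popBottom j =>
      obtain ⟨rfl, hg⟩ := hc
      rw [LState.guardLocal_iff h.mem_L] at hg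
      obtain ⟨x, q, hq⟩ := List.exists_cons_of_ne_nil hg
      simp [act, hq]
    | remove j t => obtain ⟨rfl, hg⟩ := hc; simp [act]
    | addResult t r => simp [act]
  · rintro j t rfl
    obtain ⟨rfl, ht⟩ := hc
    exact hpush t rfl ht

/-! ### Histories of the processes that follow their code -/

section Histories

variable {m : FaultModel} {f : ℕ} {faulty : Finset (Fin n)} {E : Execution W}

theorem followsCode_of_notMem {i : Fin n} (hi : i ∉ faulty) : FollowsCode m faulty i := by
  cases m
  · trivial
  · exact hi

theorem eq_byzantine_of_not_followsCode {i : Fin n} (hi : ¬ FollowsCode m faulty i) :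
    m = .byzantine ∧ i ∈ faulty := by
  cases m
  · exact absurd trivial hi
  · exact ⟨rfl, not_not.1 hi⟩

theorem Execution.At.eq {k : ℕ} {i : Fin n} {e e' : Event n T V} (h : E.At k i e)
    (h' : E.At k i e') : e = e' := by
  unfold Execution.At at h h'
  rw [h] at h'
  cases h'
  rfl

theorem IsExecution.step_or_eq (hE : IsExecution m f faulty E) {i : Fin n}
    (hi : FollowsCode m faulty i) (k : ℕ) :
    (∃ e, E.At k i e ∧ Step W i (E.state k i) e (E.state (k + 1) i)) ∨
      (∀ e, ¬ E.At k i e) ∧ E.state (k + 1) i = E.state k i := by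
  by_cases h : ∃ e, E.At k i e
  · obtain ⟨e, he⟩ := h
    exact Or.inl ⟨e, he, hE.step i hi k e he⟩
  · have h' : ∀ e, ¬ E.At k i e := fun e he => h ⟨e, he⟩
    exact Or.inr ⟨h', hE.noStep i hi k h'⟩

theorem IsExecution.exists_process_of_mem_seq (hE : IsExecution m f faulty E) {i : Fin n}
    (hi : FollowsCode m faulty i) {a : W.Sigma} : ∀ {k : ℕ}, a ∈ (E.state k i).seq →
      ∃ k' < k, ∃ j sn, E.At k' i (.process j sn a) ∧ (a : Op n T V) ∈ W.C ∪ W.O j := by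
  intro k
  induction k with
  | zero => rw [hE.init i hi]; simp [LState.init]
  | succ k ih =>
    have old : a ∈ (E.state k i).seq → ∃ k' < k + 1, ∃ j sn, E.At k' i (.process j sn a) ∧
        (a : Op n T V) ∈ W.C ∪ W.O j := fun h =>
      let ⟨k', hk', h⟩ := ih h; ⟨k', by omega, h⟩
    rcases hE.step_or_eq hi k with ⟨e, he, hst⟩ | ⟨_, heq⟩
    · generalize hs : E.state k i = s at *
      generalize hs' : E.state (k + 1) i = s' at *
      cases hst with
      | process j sn b hbuf hsn hadm =>
        intro h
        rcases List.mem_append.1 h with h | h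
        · exact old h
        · rw [List.mem_singleton] at h
          subst h
          exact ⟨k, by omega, j, sn, he, hadm.1⟩
      | _ => exact old
    · rw [heq]; exact old

theorem IsExecution.exists_rdeliver_of_mem_buf (hE : IsExecution m f faulty E) {i : Fin n}
    (hi : FollowsCode m faulty i) {j : Fin n} {sn : ℕ} {up : Op n T V} :
    ∀ {k : ℕ}, (j, sn, up) ∈ (E.state k i).buf → ∃ k' < k, E.At k' i (.rdeliver j sn up) := by
  intro k
  induction k with
  | zero => rw [hE.init i hi]; simp [LState.init]
  | succ k ih =>
    have old : (j, sn, up) ∈ (E.state k i).buf → ∃ k' < k + 1, E.At k' i (.rdeliver j sn up) :=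
      fun h => let ⟨k', hk', h⟩ := ih h; ⟨k', by omega, h⟩
    rcases hE.step_or_eq hi k with ⟨e, he, hst⟩ | ⟨_, heq⟩
    · generalize hs : E.state k i = s at *
      generalize hs' : E.state (k + 1) i = s' at *
      cases hst with
      | rdeliver j' sn' up' =>
        intro h
        rcases Set.mem_insert_iff.1 h with h | h
        · cases h
          exact ⟨k, by omega, he⟩
        · exact old h
      | process j sn b hbuf hsn hadm => exact fun h => old h.1
      | _ => exact old
    · rw [heq]; exact old

theorem Step.process_inv {i j : Fin n} {sn : ℕ} {up : Op n T V} {s s' : LState W}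
    (h : Step W i s (.process j sn up) s') : (j, sn, up) ∈ s.buf ∧ sn = s.del j + 1 ∧
      s'.del = Function.update s.del j sn := by
  cases h with
  | process j sn a hbuf hsn hadm => exact ⟨hbuf, hsn, rfl⟩

theorem Step.rbroadcast_inv {i : Fin n} {sn : ℕ} {up : Op n T V} {s s' : LState W}
    (h : Step W i s (.rbroadcast sn up) s') : s.pc = .call up ∧ sn = s.sn + 1 := by
  cases h with
  | rbroadcast a hpc hadm => exact ⟨hpc, rfl⟩

/-- What `i` processes from a process that follows its code has been broadcast. -/
theorem IsExecution.exists_rbroadcast_of_process (hE : IsExecution m f faulty E) {i j : Fin n}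
    (hi : FollowsCode m faulty i) (hj : FollowsCode m faulty j) {k sn : ℕ} {up : Op n T V}
    (h : E.At k i (.process j sn up)) : ∃ k' < k, E.At k' j (.rbroadcast sn up) := by
  obtain ⟨k', hk', h'⟩ :=
    hE.exists_rdeliver_of_mem_buf hi (hE.step i hi k _ h).process_inv.1
  obtain ⟨k'', hk'', h''⟩ := hE.broadcast.validity i j hi hj k' sn up h'
  exact ⟨k'', by omega, h''⟩

/-- What must have happened at process `i` before time `k`, according to its position in the code. -/
def PCHistory (E : Execution W) (i : Fin n) (k : ℕ) : Prop :=
  match (E.state k i).pc with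
  | .call (.pushBottom _ t) => ∃ k' < k, E.At k' i (.invoke t)
  | .call (.addResult t r) => ∃ k' < k, E.At k' i (.execute t r) ∧
      ∃ a ∈ (E.state k' i).seq, (a : Op n T V) = .pushBottom (W.owner t) t
  | .execRemote t => ∃ a ∈ (E.state k i).seq, (a : Op n T V) = .pushBottom (W.owner t) t
  | _ => True

/-- Nothing is assumed about the application of `i` here, because the lemma is also applied to
thieves, whose own submissions are arbitrary. -/
theorem IsExecution.history (hE : IsExecution m f faulty E) {i : Fin n}
    (hi : FollowsCode m faulty i) (k : ℕ) :
    (∀ t ∈ (E.state k i).pending, ∃ k' < k, E.At k' i (.invoke t)) ∧ PCHistory E i k := by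
  induction k with
  | zero => unfold PCHistory; rw [hE.init i hi]; simp [LState.init]
  | succ k ih =>
    have old : ∀ {P : ℕ → Prop}, (∃ k' < k, P k') → ∃ k' < k + 1, P k' :=
      fun ⟨k', hk', h⟩ => ⟨k', by omega, h⟩
    obtain ⟨ihp, ihc⟩ := ih
    have ihp' := fun t ht => old (ihp t ht)
    rcases hE.step_or_eq hi k with ⟨e, he, hst⟩ | ⟨_, heq⟩
    · unfold PCHistory at ihc ⊢
      generalize hs : E.state k i = s at *
      generalize hs' : E.state (k + 1) i = s' at *
      -- For steps that keep `pc`, while `seq` may grow to `l`.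
      have mono : ∀ {l : List W.Sigma}, (∀ a ∈ s.seq, a ∈ l) →
          (match s.pc with
            | .call (.pushBottom _ t) => ∃ k' < k + 1, E.At k' i (.invoke t)
            | .call (.addResult t r) => ∃ k' < k + 1, E.At k' i (.execute t r) ∧
                ∃ a ∈ (E.state k' i).seq, (a : Op n T V) = .pushBottom (W.owner t) t
            | .execRemote t => ∃ a ∈ l, (a : Op n T V) = .pushBottom (W.owner t) t
            | _ => True) := by
        intro l hl
        split
        · rename_i hc; simp only [hc] at ihc; exact old ihc
        · rename_i hc; simp only [hc] at ihc; exact old ihc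
        · rename_i hc; simp only [hc] at ihc
          obtain ⟨a, ha, h⟩ := ihc
          exact ⟨a, hl a ha, h⟩
        · trivial
      cases hst with
      | invoke t =>
        refine ⟨fun t' ht' => ?_, mono (fun _ h => h)⟩
        rcases Multiset.mem_cons.1 ht' with rfl | h
        · exact ⟨k, by omega, he⟩
        · exact ihp' _ h
      | rdeliver j sn up => exact ⟨ihp', mono (fun _ h => h)⟩
      | process j sn a hbuf hsn hadm =>
        exact ⟨ihp', mono (fun _ h => List.mem_append_left _ h)⟩
      | enterSubmit t p hpc hp =>
        refine ⟨fun t' ht' => ihp' _ ?_, ihp' _ ?_⟩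
        · rw [hp]; exact Multiset.mem_cons_of_mem ht'
        · rw [hp]; exact Multiset.mem_cons_self _ _
      | readTop_some j t hpc ht =>
        refine ⟨ihp', ?_⟩
        simp only [App.getTop] at ht
        obtain ⟨q, hq, hqt⟩ := Option.bind_eq_some_iff.1 ht
        have hmem := List.mem_of_getLast? hqt
        change ∃ a ∈ s.seq, (a : Op n T V) = .pushBottom (W.owner t) t
        rw [App.owner_of_mem hq hmem]
        exact App.exists_pushBottom_of_mem _ hq hmem
      | execute_remote t r hpc hr =>
        simp only [hpc] at ihc
        refine ⟨ihp', k, by omega, he, ?_⟩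
        rw [hs]
        exact ihc
      | applyReturn up hpc hdel =>
        refine ⟨ihp', ?_⟩
        -- A returning `apply` leads to none of the three positions recorded by `PCHistory`.
        cases up <;> cases ho : s.out <;> simp [afterApply]
      | _ => exact ⟨ihp', trivial⟩
    · unfold PCHistory at ihc ⊢
      rw [heq]
      refine ⟨ihp', ?_⟩
      split
      · rename_i hc; simp only [hc] at ihc; exact old ihc
      · rename_i hc; simp only [hc] at ihc; exact old ihc
      · rename_i hc; simp only [hc] at ihc; exact ihc
      · trivial

/-- A task that has been pushed has been submitted before, if its owner follows its code. -/
theorem IsExecution.exists_invoke_of_mem_seq (hE : IsExecution m f faulty E) {i j : Fin n}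
    (hi : FollowsCode m faulty i) (hj : FollowsCode m faulty j) {k : ℕ} {a : W.Sigma} {t : T}
    (ha : a ∈ (E.state k i).seq) (hat : (a : Op n T V) = .pushBottom j t) :
    ∃ k' < k, E.At k' j (.invoke t) := by
  obtain ⟨k₁, hk₁, j', sn, hp, hO⟩ := hE.exists_process_of_mem_seq hi ha
  rw [hat] at hO hp
  -- The test on the sender makes `j` the author of the push; not even a Byzantine process can push
  -- for another one.
  obtain ⟨rfl, _⟩ := App.pushBottom_mem_C_union_O hO
  obtain ⟨k₂, hk₂, hb⟩ := hE.exists_rbroadcast_of_process hi hj hp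
  have hpc := (hE.step _ hj k₂ _ hb).rbroadcast_inv.1
  have hh := (hE.history hj k₂).2
  unfold PCHistory at hh
  rw [hpc] at hh
  obtain ⟨k₃, hk₃, h⟩ := hh
  exact ⟨k₃, by omega, h⟩

/-- A result that `i` sees for `t` has been computed by a process that follows its code, after the
submission of `t`, or it has been published by a Byzantine process. -/
theorem IsExecution.executedBetween_of_mem_getResults (hE : IsExecution m f faulty E) {i : Fin n}
    (hi : FollowsCode m faulty i) {k k₀ : ℕ} {t : T} {r : V} (ht : W.owner t = i)
    (honce : ∀ k, E.At k i (.invoke t) → k = k₀)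
    (hr : r ∈ W.getResults t (W.trace (E.state k i).seq)) :
    W.Valid t r ∧ ExecutedBetween m faulty E i t k₀ k := by
  obtain ⟨a, ha, hat⟩ := (App.getResults_trace t _ r).1 hr
  have hv : W.Valid t r := App.valid_of_mem (hat ▸ a.2)
  refine ⟨hv, ?_⟩
  obtain ⟨k₁, hk₁, l, sn, hp, hO⟩ := hE.exists_process_of_mem_seq hi ha
  rw [hat] at hp
  -- If the publisher follows its code, time runs strictly backwards through processing at `i`,
  -- broadcast, `execute` and submission.
  by_cases hl : FollowsCode m faulty l
  · obtain ⟨k₂, hk₂, hb⟩ := hE.exists_rbroadcast_of_process hi hl hp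
    have hpc := (hE.step _ hl k₂ _ hb).rbroadcast_inv.1
    have hh := (hE.history hl k₂).2
    unfold PCHistory at hh
    rw [hpc] at hh
    obtain ⟨k₃, hk₃, hex, b, hb, hbt⟩ := hh
    rw [ht] at hbt
    obtain ⟨k₄, hk₄, hinv⟩ := hE.exists_invoke_of_mem_seq hl hi hb hbt
    have := honce _ hinv
    exact Or.inl ⟨l, hl, k₃, r, by omega, by omega, hex⟩
  · obtain ⟨hm, hlf⟩ := eq_byzantine_of_not_followsCode hl
    exact Or.inr ⟨hm, l, hlf, k₁, sn, r, hk₁, hv, hp⟩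

theorem ExecutedBetween.mono {i : Fin n} {t : T} {k k₁ k₂ : ℕ}
    (h : ExecutedBetween m faulty E i t k k₁) (hk : k₁ ≤ k₂) :
    ExecutedBetween m faulty E i t k k₂ := by
  rcases h with ⟨l, hl, k', r, h₁, h₂, h₃⟩ | ⟨hm, l, hl, k', sn, r, h₁, h₂⟩
  · exact Or.inl ⟨l, hl, k', r, h₁, by omega, h₃⟩
  · exact Or.inr ⟨hm, l, hl, k', sn, r, by omega, h₂⟩

end Histories

/-! ### Global invariant of a correct process -/

section Correct

variable {m : FaultModel} {f : ℕ} {faulty : Finset (Fin n)} {E : Execution W}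

/-- How the broadcasts and deliveries of `i` before time `k` relate to its state. -/
structure BroadcastInv (E : Execution W) (i : Fin n) (k : ℕ) : Prop where
  sent : ∀ k' < k, ∀ sn up, E.At k' i (.rbroadcast sn up) →
    sn ≤ (E.state k i).sn ∧ (sn = (E.state k i).del i + 1 → (E.state k i).pc = .wait up)
  waiting : ∀ up, (E.state k i).pc = .wait up → (E.state k i).sn = (E.state k i).del i + 1 →
    ∃ k' < k, E.At k' i (.rbroadcast (E.state k i).sn up)
  delivered : ∀ k' < k, ∀ sn up, E.At k' i (.rdeliver i sn up) → (E.state k i).del i < sn →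
    (i, sn, up) ∈ (E.state k i).buf

open Classical in
/-- The number of submissions of `t` by `i` before time `k`. -/
noncomputable def invocations (E : Execution W) (i : Fin n) (t : T) (k : ℕ) : ℕ :=
  Nat.count (fun k' => E.At k' i (.invoke t)) k

open Classical in
/-- The number of publications of `t` by `i` before time `k`. -/
noncomputable def publications (E : Execution W) (i : Fin n) (t : T) (k : ℕ) : ℕ :=
  Nat.count (fun k' => ∃ r, E.At k' i (.publish t r)) k

theorem invocations_succ (E : Execution W) (i : Fin n) (t : T) (k : ℕ) :
    invocations E i t (k + 1) = invocations E i t k + ind (E.At k i (.invoke t)) := by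
  rw [invocations, Nat.count_succ, ite_eq_ind]
  rfl

theorem publications_succ (E : Execution W) (i : Fin n) (t : T) (k : ℕ) :
    publications E i t (k + 1) = publications E i t k + ind (∃ r, E.At k i (.publish t r)) := by
  rw [publications, Nat.count_succ, ite_eq_ind]
  rfl

theorem publications_mono (E : Execution W) (i : Fin n) (t : T) : Monotone (publications E i t) := by
  classical exact Nat.count_monotone _

theorem invocations_mono (E : Execution W) (i : Fin n) (t : T) : Monotone (invocations E i t) := by
  classical exact Nat.count_monotone _

theorem exists_of_invocations_pos {i : Fin n} {t : T} {k : ℕ} (h : 0 < invocations E i t k) :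
    ∃ k' < k, E.At k' i (.invoke t) := by
  classical
  unfold invocations at h
  rw [Nat.count_eq_card_filter_range, Finset.card_pos] at h
  obtain ⟨k', hk'⟩ := h
  simp only [Finset.mem_filter, Finset.mem_range] at hk'
  exact ⟨k', hk'⟩

theorem exists_of_publications_pos {i : Fin n} {t : T} {k : ℕ} (h : 0 < publications E i t k) :
    ∃ k' < k, ∃ r, E.At k' i (.publish t r) := by
  classical
  unfold publications at h
  rw [Nat.count_eq_card_filter_range, Finset.card_pos] at h
  obtain ⟨k', hk'⟩ := h
  simp only [Finset.mem_filter, Finset.mem_range] at hk'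
  exact ⟨k', hk'⟩

theorem invocations_le_one {i : Fin n} {t : T}
    (honce : ∀ k k', E.At k i (.invoke t) → E.At k' i (.invoke t) → k = k') (k : ℕ) :
    invocations E i t k ≤ 1 := by
  classical
  unfold invocations
  rw [Nat.count_eq_card_filter_range, Finset.card_le_one]
  simp only [Finset.mem_filter, Finset.mem_range]
  exact fun a ha b hb => honce a b ha.2 hb.2

/-- The invariant of a correct process whose application submits its own tasks, each at most
once. -/
structure Inv (E : Execution W) (i : Fin n) (k : ℕ) : Prop where
  loc : LInv i (E.state k i)
  broadcast : BroadcastInv E i k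
  submitted : ∀ t (ht : W.owner t = i), submitting i t (E.state k i) +
    W.count (W.pushLetter ht) (W.trace (E.state k i).seq) = invocations E i t k
  pushed : ∀ t (ht : W.owner t = i), W.count (W.pushLetter ht) (W.trace (E.state k i).seq) =
    stored i t (E.state k i) + publishing i t (E.state k i) + publications E i t k
  once : ∀ t, invocations E i t k ≤ 1

/-- The push being prepared already uses up the single invocation of `t`. -/
theorem Inv.pushLetter_notMem {i : Fin n} {k : ℕ} (h : Inv E i k) {t : T} (ht : W.owner t = i)
    (hp : Prep i (E.state k i) (.pushBottom i t)) : W.pushLetter ht ∉ (E.state k i).seq := by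
  rw [← App.count_pos_iff]
  have h1 := h.submitted t ht
  have h2 := h.once t
  simp only [submitting, hp, ind_true] at h1
  omega

/-- The client waits for each update before it calls the next, so at most one is in flight. -/
theorem LInv.sn_bounds {i : Fin n} {s : LState W} (h : LInv i s) :
    s.del i ≤ s.sn ∧ s.sn ≤ s.del i + 1 := by
  have := h.pcInv
  unfold PCInv at this
  split at this <;> first | omega | exact this.elim

theorem LInv.del_eq {i : Fin n} {s : LState W} (h : LInv i s) (hpc : ∀ up, s.pc ≠ .wait up) :
    s.del i = s.sn := by
  have := h.pcInv
  unfold PCInv at this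
  split at this
  · exact this.1
  · exact absurd ‹_› (hpc _)
  · exact this.1
  · exact this.elim
  · exact this

/-- Number `del i + 1` can only belong to the latest broadcast, and an own message leaves `buf` only
when `del i` is raised to its number. -/
theorem BroadcastInv.step {i : Fin n}
    {k : ℕ} {e : Event n T V} (hl : LInv i (E.state k i))
    (h : BroadcastInv E i k) (he : E.At k i e)
    (hst : Step W i (E.state k i) e (E.state (k + 1) i))
    (hreg : Regular i (E.state k i) e) : BroadcastInv E i (k + 1) := by
  have hb := hl.sn_bounds
  obtain ⟨hsent, hwait, hdel⟩ := h
  have earlier : ∀ {k'}, k' < k + 1 → k' ≠ k → k' < k := fun h h' => by omega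
  have sent' : (∀ sn up, e ≠ .rbroadcast sn up) → ∀ k' < k + 1, ∀ sn up,
      E.At k' i (.rbroadcast sn up) → sn ≤ (E.state k i).sn ∧
        (sn = (E.state k i).del i + 1 → (E.state k i).pc = .wait up) := by
    intro hne k' hk' sn up h
    by_cases hkk : k' = k
    · subst hkk; exact absurd (he.eq h) (hne sn up)
    · exact hsent k' (earlier hk' hkk) sn up h
  have deliv' : (∀ sn up, e ≠ .rdeliver i sn up) → ∀ k' < k + 1, ∀ sn up,
      E.At k' i (.rdeliver i sn up) → (E.state k i).del i < sn →
        (i, sn, up) ∈ (E.state k i).buf := by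
    intro hne k' hk' sn up h
    by_cases hkk : k' = k
    · subst hkk; exact absurd (he.eq h) (hne sn up)
    · exact hdel k' (earlier hk' hkk) sn up h
  have wait' : ∀ up, (E.state k i).pc = .wait up → (E.state k i).sn = (E.state k i).del i + 1 →
      ∃ k' < k + 1, E.At k' i (.rbroadcast (E.state k i).sn up) := fun up h h' =>
    let ⟨k', hk', hb⟩ := hwait up h h'; ⟨k', by omega, hb⟩
  have other : ∀ {s}, E.state (k + 1) i = s → (∀ up, (E.state k i).pc ≠ .wait up) →
      (∀ up, s.pc ≠ .wait up) → s.sn = (E.state k i).sn → s.del = (E.state k i).del →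
      s.buf = (E.state k i).buf → (∀ sn up, e ≠ .rbroadcast sn up) →
      (∀ sn up, e ≠ .rdeliver i sn up) → BroadcastInv E i (k + 1) := by
    rintro s rfl hpc hpc' hsn hd hbuf hne hne'
    constructor
    · intro k' hk' sn up h
      obtain ⟨h1, h2⟩ := sent' hne k' hk' sn up h
      rw [hsn, hd]
      exact ⟨h1, fun h3 => absurd (h2 h3) (hpc up)⟩
    · exact fun up h => absurd h (hpc' up)
    · rw [hd, hbuf]
      exact deliv' hne'
  generalize hs : E.state k i = s at *
  generalize hs' : E.state (k + 1) i = s' at *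
  cases hst with
  | invoke t =>
    exact ⟨by rw [hs']; exact sent' (by simp), by rw [hs']; exact wait',
      by rw [hs']; exact deliv' (by simp)⟩
  | rdeliver j sn up =>
    refine ⟨by rw [hs']; exact sent' (by simp), by rw [hs']; exact wait', ?_⟩
    rw [hs']
    intro k' hk' sn' up' h hlt
    by_cases hkk : k' = k
    · subst hkk
      cases he.eq h
      exact Set.mem_insert _ _
    · exact Set.mem_insert_of_mem _ (hdel k' (earlier hk' hkk) sn' up' h hlt)
  | process j sn a hbuf hsn hadm =>
    by_cases hj : j = i
    · subst hj
      obtain ⟨hw, hd⟩ := hreg.process _ _ rfl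
      constructor <;> rw [hs']
      · intro k' hk' sn' up' h
        obtain ⟨h1, _⟩ := sent' (by simp) k' hk' sn' up' h
        refine ⟨h1, fun h2 => ?_⟩
        simp only [Function.update_self] at h2
        omega
      · intro up _ h2
        simp only [Function.update_self] at h2
        omega
      · intro k' hk' sn' up' h hlt
        simp only [Function.update_self] at hlt
        refine ⟨deliv' (by simp) k' hk' sn' up' h (by omega), ?_⟩
        -- The removed triple has number `sn`, which `hlt` makes smaller than `sn'`.
        simp only [Set.mem_singleton_iff, Prod.mk.injEq, not_and]
        omega
    · have hji : i ≠ j := Ne.symm hj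
      constructor <;> rw [hs'] <;> simp only [Function.update_of_ne hji]
      · exact sent' (by simp)
      · exact wait'
      · intro k' hk' sn' up' h hlt
        refine ⟨deliv' (by simp) k' hk' sn' up' h hlt, ?_⟩
        simp [hji]
  | rbroadcast a hpc hadm =>
    have hds := hl.del_eq (by simp [hpc])
    constructor <;> rw [hs']
    · intro k' hk' sn' up' h
      by_cases hkk : k' = k
      · subst hkk
        cases he.eq h
        exact ⟨le_rfl, fun _ => rfl⟩
      -- Earlier numbers are at most the old `sn`, which equals `del i`, hence never `del i + 1`.
      · obtain ⟨h1, _⟩ := hsent k' (earlier hk' hkk) sn' up' h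
        refine ⟨by simp only; omega, fun h2 => ?_⟩
        simp only at h2
        omega
    · intro up h _
      cases h
      exact ⟨k, by omega, he⟩
    · exact deliv' (by simp)
  | applyReturn up hpc hdl =>
    have : ∀ up', afterApply up s.out ≠ .wait up' := by
      intro up'
      cases up <;> cases s.out <;> simp [afterApply]
    constructor <;> rw [hs']
    · intro k' hk' sn' up' h
      obtain ⟨h1, _⟩ := sent' (by simp) k' hk' sn' up' h
      exact ⟨h1, fun h2 => by simp only at h2; omega⟩
    · exact fun up' h => absurd h (this up')
    · exact deliv' (by simp)
  | abort => exact absurd rfl hreg.abort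
  | enterSubmit t p hpc hp =>
    exact other rfl (by simp [hpc]) (by simp) rfl rfl rfl (by simp) (by simp)
  | enterLocal hpc hg =>
    exact other rfl (by simp [hpc]) (by simp) rfl rfl rfl (by simp) (by simp)
  | enterSteal j hpc hg =>
    exact other rfl (by simp [hpc]) (by simp) rfl rfl rfl (by simp) (by simp)
  | enterCollect t hpc hg =>
    exact other rfl (by simp [hpc]) (by simp) rfl rfl rfl (by simp) (by simp)
  | readTop_some j t hpc ht =>
    exact other rfl (by simp [hpc]) (by simp) rfl rfl rfl (by simp) (by simp)
  | readTop_none j hpc ht =>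
    exact other rfl (by simp [hpc]) (by simp) rfl rfl rfl (by simp) (by simp)
  | execute_local t r hpc hr =>
    exact other rfl (by simp [hpc]) (by simp) rfl rfl rfl (by simp) (by simp)
  | execute_remote t r hpc hr =>
    exact other rfl (by simp [hpc]) (by simp) rfl rfl rfl (by simp) (by simp)
  | choose t r hpc hr =>
    exact other rfl (by simp [hpc]) (by simp) rfl rfl rfl (by simp) (by simp)
  | publish t r hpc =>
    exact other rfl (by simp [hpc]) (by simp) rfl rfl rfl (by simp) (by simp)

theorem Inv.zero (hE : IsExecution m f faulty E) {i : Fin n} (hi : FollowsCode m faulty i) :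
    Inv E i 0 where
  loc := by rw [hE.init i hi]; exact LInv.init i
  broadcast := by constructor <;> simp [hE.init i hi, LState.init]
  submitted t ht := by
    rw [hE.init i hi]
    simp [submitting, LState.init, Prep, invocations, App.trace_nil, App.count_one]
  pushed t ht := by
    rw [hE.init i hi]
    simp [stored, publishing, LState.init, LState.deque, Post, publications, App.trace_nil,
      App.count_one, App.dState_one]
  once t := by simp [invocations]

/-- By validity of the broadcast from `i` to itself, a processed own update was sent by `i`, and its
number `del i + 1` identifies it as the awaited one. An abort would contradict
`LInv.exists_admissible`. -/
theorem Inv.regular (hE : IsExecution m f faulty E) {i : Fin n} (hi : FollowsCode m faulty i)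
    (howner : ∀ k t, E.At k i (.invoke t) → W.owner t = i)
    {k : ℕ} {e : Event n T V} (h : Inv E i k) (he : E.At k i e) : Regular i (E.state k i) e where
  process := by
    rintro sn up rfl
    obtain ⟨_, hsn, _⟩ := (hE.step i hi k _ he).process_inv
    obtain ⟨k', hk', hb⟩ := hE.exists_rbroadcast_of_process hi hi he
    obtain ⟨h1, h2⟩ := h.broadcast.sent k' hk' sn up hb
    have := h.loc.sn_bounds
    exact ⟨h2 hsn, by omega⟩
  abort := by
    rintro rfl
    have hst := hE.step i hi k _ he
    have hl := h.loc
    have hnot := fun {t} => h.pushLetter_notMem (t := t)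
    generalize hs : E.state k i = s at *
    generalize hs' : E.state (k + 1) i = s' at *
    cases hst with
    | abort up hpc hadm =>
      have hp := hl.pcInv
      unfold PCInv at hp
      simp only [hpc] at hp
      refine hadm (hl.exists_admissible hp.2 ?_)
      rintro t rfl ht
      exact hnot ht (Or.inl hpc)
  invoke := by
    rintro t rfl
    exact howner k t he

theorem Inv.step (hE : IsExecution m f faulty E) {i : Fin n} (hi : FollowsCode m faulty i)
    (howner : ∀ k t, E.At k i (.invoke t) → W.owner t = i)
    (honce : ∀ k k' t, E.At k i (.invoke t) → E.At k' i (.invoke t) → k = k')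
    {k : ℕ} (h : Inv E i k) : Inv E i (k + 1) := by
  rcases hE.step_or_eq hi k with ⟨e, he, hst⟩ | ⟨hno, heq⟩
  · have hreg := h.regular hE hi howner he
    have hev : ∀ {e'}, E.At k i e' ↔ e = e' := fun {e'} => ⟨fun h => he.eq h, fun h => h ▸ he⟩
    refine ⟨h.loc.step hst hreg, h.broadcast.step h.loc he hst hreg, fun t ht => ?_,
      fun t ht => ?_, fun t => invocations_le_one (fun k k' => honce k k' t) _⟩
    · rw [invocations_succ, h.loc.submitting_step hst hreg ht, h.submitted t ht, hev]
    · have h1 := h.pushed t ht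
      have h2 := h.submitted t ht
      have h3 := h.once t
      have h4 := h.loc.stored_step hst hreg ht (by omega)
      rw [publications_succ]
      simp only [hev]
      omega
  · refine ⟨by rw [heq]; exact h.loc, ?_, fun t ht => ?_, fun t ht => ?_,
      fun t => invocations_le_one (fun k k' => honce k k' t) _⟩
    · obtain ⟨h1, h2, h3⟩ := h.broadcast
      have earlier : ∀ {k' e}, k' < k + 1 → E.At k' i e → k' < k := by
        intro k' e hk' he
        have : k' ≠ k := by rintro rfl; exact hno e he
        omega
      constructor <;> rw [heq]
      · exact fun k' hk' sn up hb => h1 k' (earlier hk' hb) sn up hb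
      · exact fun up h h' => let ⟨k', hk', hb⟩ := h2 up h h'; ⟨k', by omega, hb⟩
      · exact fun k' hk' sn up hb => h3 k' (earlier hk' hb) sn up hb
    · rw [heq, invocations_succ, h.submitted t ht]; simp [hno]
    · rw [heq, publications_succ, h.pushed t ht]; simp [hno]

theorem IsExecution.inv (hE : IsExecution m f faulty E) {i : Fin n} (hi : FollowsCode m faulty i)
    (howner : ∀ k t, E.At k i (.invoke t) → W.owner t = i)
    (honce : ∀ k k' t, E.At k i (.invoke t) → E.At k' i (.invoke t) → k = k')
    (k : ℕ) : Inv E i k := by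
  induction k with
  | zero => exact Inv.zero hE hi
  | succ k ih => exact ih.step hE hi howner honce

end Correct

/-! ### Progress of the client -/

/-- A bound on the number of statements left before the block in the monitor ends. -/
def PC.rank : PC n T V → ℕ
  | .idle => 0
  | .call _ => 4
  | .wait _ => 3
  | .steal _ => 6
  | .execLocal _ => 2
  | .execRemote _ => 5
  | .choose _ => 2
  | .publish _ _ => 1
  | .aborted => 0

theorem Step.rank_lt {i : Fin n} {s s' : LState W} {e : Event n T V}
    (hst : Step W i s e s') (hreg : Regular i s e) (he : e.InBlock) :
    s'.pc.rank < s.pc.rank := by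
  cases hst with
  | abort => exact absurd rfl hreg.abort
  | applyReturn up hpc hdel =>
    rw [hpc]
    cases up <;> cases ho : s.out <;> simp [afterApply, PC.rank]
  | _ => simp_all [Event.InBlock, PC.rank]

theorem Step.pc_eq {i : Fin n} {s s' : LState W} {e : Event n T V}
    (hst : Step W i s e s') (he : ¬ e.InBlock) (hpc : s.pc ≠ .idle) :
    s'.pc = s.pc ∧ s'.sn = s.sn ∧ s.del i ≤ s'.del i := by
  cases hst with
  | process j sn a hbuf hsn hadm =>
    refine ⟨rfl, rfl, ?_⟩
    by_cases hj : i = j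
    · subst hj
      simp [hsn]
    · simp [Function.update_of_ne hj]
  | _ => simp_all [Event.InBlock]

/-- Only a wait can be disabled. The invariant provides a result for `choose` and excludes
`aborted`. -/
theorem LInv.exists_inBlock_step {i : Fin n} {s : LState W} (hvalid : ∀ t, ∃ r, W.Valid t r)
    (h : LInv i s) (hpc : s.pc ≠ .idle) (hw : ∀ up, s.pc = .wait up → s.del i = s.sn) :
    ∃ e s', e.InBlock ∧ Step W i s e s' := by
  have hp := h.pcInv
  unfold PCInv at hp
  cases hc : s.pc with
  | idle => exact absurd hc hpc
  | call up =>
    by_cases ha : ∃ a : W.Sigma, (a : Op n T V) = up ∧ Admissible W i s.seq a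
    · obtain ⟨a, rfl, ha⟩ := ha
      exact ⟨_, _, by exact trivial, Step.rbroadcast s a hc ha⟩
    · exact ⟨_, _, by exact trivial, Step.abort s up hc ha⟩
  | wait up => exact ⟨_, _, by exact trivial, Step.applyReturn s up hc (hw up hc)⟩
  | steal j =>
    cases ht : W.getTop j (W.trace s.seq) with
    | none => exact ⟨_, _, by exact trivial, Step.readTop_none s j hc ht⟩
    | some t => exact ⟨_, _, by exact trivial, Step.readTop_some s j t hc ht⟩
  | execLocal t =>
    obtain ⟨r, hr⟩ := hvalid t
    exact ⟨_, _, by exact trivial, Step.execute_local s t r hc hr⟩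
  | execRemote t =>
    obtain ⟨r, hr⟩ := hvalid t
    exact ⟨_, _, by exact trivial, Step.execute_remote s t r hc hr⟩
  | choose t =>
    simp only [hc] at hp
    obtain ⟨r, hr⟩ := hp.2
    exact ⟨_, _, by exact trivial, Step.choose s t r hc hr⟩
  | publish t r => exact ⟨_, _, by exact trivial, Step.publish s t r hc⟩
  | aborted => simp only [hc] at hp

section Progress

variable {m : FaultModel} {f : ℕ} {faulty : Finset (Fin n)} {E : Execution W}

/-- An update of `i` on which the client waits is eventually processed. -/
theorem IsExecution.exists_del_eq_sn (hE : IsExecution m f faulty E) {i : Fin n} (hi : i ∉ faulty)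
    (hinv : ∀ k, Inv E i k) {k : ℕ} {up : Op n T V}
    (hpc : ∀ k' ≥ k, (E.state k' i).pc = .wait up)
    (hsn : ∀ k' ≥ k, (E.state k' i).sn = (E.state k i).sn) :
    ∃ k' ≥ k, (E.state k' i).del i = (E.state k' i).sn := by
  -- Otherwise the update stays unprocessed, with `sn = del i + 1` from `k` on.
  by_contra! hne
  have hF : FollowsCode m faulty i := followsCode_of_notMem hi
  have hsucc : ∀ k' ≥ k, (E.state k' i).sn = (E.state k' i).del i + 1 := by
    intro k' hk'
    have := (hinv k').loc.sn_bounds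
    have := hne k' hk'
    omega
  obtain ⟨k₁, hk₁, hb⟩ := (hinv k).broadcast.waiting up (hpc k le_rfl) (hsucc k le_rfl)
  obtain ⟨k₂, hd⟩ := hE.broadcast.termination₁ i hi k₁ _ up hb
  obtain ⟨k₃, hk₃, hp⟩ := (hE.fair i hi).process (max k (k₂ + 1)) i (E.state k i).sn up (by
    intro k' hk'
    have hkk : k ≤ k' := le_trans (le_max_left _ _) hk'
    have hk2 : k₂ < k' := lt_of_lt_of_le (Nat.lt_succ_self _) (le_trans (le_max_right _ _) hk')
    have h1 := hsucc k' hkk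
    have h2 := hsn k' hkk
    have hl := (hinv k').loc
    have hpI := hl.pcInv
    unfold PCInv at hpI
    simp only [hpc k' hkk] at hpI
    rcases hpI with ⟨_, hc⟩ | ⟨h3, _⟩
    swap
    · omega
    have hbuf := (hinv k').broadcast.delivered k₂ hk2 _ up hd (by omega)
    obtain ⟨a, rfl, ha⟩ := hl.exists_admissible hc (by
      rintro t rfl ht
      exact (hinv k').pushLetter_notMem ht (Or.inr ⟨hpc k' hkk, h1⟩))
    exact ⟨_, Step.process _ i _ a hbuf (by omega) ha⟩)
  have hkk : k ≤ k₃ := le_trans (le_max_left _ _) hk₃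
  have h1 := (hE.step i hF k₃ _ hp).process_inv.2.2
  have h2 := hsucc (k₃ + 1) (by omega)
  have h3 := hsn (k₃ + 1) (by omega)
  rw [h1, Function.update_self] at h2
  omega

/-- The block in the monitor of a correct process makes progress. -/
theorem IsExecution.exists_rank_lt (hE : IsExecution m f faulty E)
    (hvalid : ∀ t, ∃ r, W.Valid t r) {i : Fin n} (hi : i ∉ faulty)
    (hinv : ∀ k, Inv E i k) (hreg : ∀ k e, E.At k i e → Regular i (E.state k i) e) {k : ℕ}
    (hpc : (E.state k i).pc ≠ .idle) :
    ∃ k' ≥ k, (E.state k' i).pc.rank < (E.state k i).pc.rank := by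
  -- If the rank never drops, no statement of the block is executed: `pc` and `sn` are frozen, and
  -- `del i` can only grow.
  by_contra! hle
  have hF : FollowsCode m faulty i := followsCode_of_notMem hi
  have hno : ∀ k' ≥ k, (E.state k' i).pc = (E.state k i).pc →
      ∀ e, e.InBlock → ¬ E.At k' i e := by
    intro k' hk' h e he hat
    have h1 := (hE.step i hF k' e hat).rank_lt (hreg k' e hat) he
    have h2 := hle (k' + 1) (by omega)
    rw [h] at h1
    omega
  have hstep : ∀ k' ≥ k, (E.state k' i).pc = (E.state k i).pc →
      (E.state (k' + 1) i).pc = (E.state k' i).pc ∧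
      (E.state (k' + 1) i).sn = (E.state k' i).sn ∧
      (E.state k' i).del i ≤ (E.state (k' + 1) i).del i := by
    intro k' hk' h
    rcases hE.step_or_eq hF k' with ⟨e, he, hst⟩ | ⟨_, heq⟩
    · exact hst.pc_eq (fun hb => hno k' hk' h e hb he) (by rw [h]; exact hpc)
    · rw [heq]; exact ⟨rfl, rfl, le_rfl⟩
  have hconst : ∀ k' ≥ k, (E.state k' i).pc = (E.state k i).pc := by
    intro k' hk'
    induction k', hk' using Nat.le_induction with
    | base => rfl
    | succ k' hk' ih => rw [(hstep k' hk' ih).1, ih]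
  have hsn : ∀ k₁ ≥ k, ∀ k' ≥ k₁, (E.state k' i).sn = (E.state k₁ i).sn ∧
      (E.state k₁ i).del i ≤ (E.state k' i).del i := by
    intro k₁ hk₁ k' hk'
    induction k', hk' using Nat.le_induction with
    | base => exact ⟨rfl, le_rfl⟩
    | succ k' hk' ih =>
      obtain ⟨_, h1, h2⟩ := hstep k' (by omega) (hconst k' (by omega))
      exact ⟨h1.trans ih.1, ih.2.trans h2⟩
  obtain ⟨K, hK, hen⟩ : ∃ K ≥ k, ∀ k' ≥ K, ∀ up, (E.state k' i).pc = .wait up →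
      (E.state k' i).del i = (E.state k' i).sn := by
    by_cases hw : ∃ up, (E.state k i).pc = .wait up
    · obtain ⟨up, hw⟩ := hw
      obtain ⟨K, hK, hd⟩ := hE.exists_del_eq_sn hi hinv (up := up)
        (fun k' hk' => (hconst k' hk').trans hw) (fun k' hk' => (hsn k le_rfl k' hk').1)
      refine ⟨K, hK, fun k' hk' _ _ => ?_⟩
      have h1 := hsn K hK k' hk'
      have h2 := (hinv k').loc.sn_bounds
      omega
    · exact ⟨k, le_rfl, fun k' hk' up h => absurd ⟨up, (hconst k' hk').symm.trans h⟩ hw⟩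
  obtain ⟨k', hk', e, he, hat⟩ := (hE.fair i hi).inBlock K (fun k' hk' =>
    (hinv k').loc.exists_inBlock_step hvalid (by rw [hconst k' (by omega)]; exact hpc) (hen k' hk'))
  exact hno k' (by omega) (hconst k' (by omega)) e he hat

/-- The monitor of a correct process is free infinitely often. -/
theorem IsExecution.freeInfOften (hE : IsExecution m f faulty E)
    (hvalid : ∀ t, ∃ r, W.Valid t r) {i : Fin n} (hi : i ∉ faulty)
    (hinv : ∀ k, Inv E i k) (hreg : ∀ k e, E.At k i e → Regular i (E.state k i) e) :
    E.FreeInfOften i := by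
  intro K
  induction hr : (E.state K i).pc.rank using Nat.strong_induction_on generalizing K with
  | _ r ih =>
    by_cases hpc : (E.state K i).pc = .idle
    · exact ⟨K, le_rfl, hpc⟩
    · obtain ⟨k', hk', hlt⟩ := hE.exists_rank_lt hvalid hi hinv hreg hpc
      obtain ⟨k, hk, h⟩ := ih _ (hr ▸ hlt) k' rfl
      exact ⟨k, by omega, h⟩

end Progress

/-! ### Progress of a task -/

theorem Step.seq_subset {i : Fin n} {s s' : LState W} {e : Event n T V}
    (hst : Step W i s e s') : s.seq ⊆ s'.seq := by
  cases hst with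
  | process j sn a hbuf hsn hadm => exact List.subset_append_left _ _
  | _ => exact List.Subset.refl _

theorem Step.mem_pending {i : Fin n} {s s' : LState W} {e : Event n T V} {t : T}
    (hst : Step W i s e s') (h : t ∈ s'.pending) : t ∈ s.pending ∨ e = .invoke t := by
  cases hst with
  | invoke t' =>
    rcases Multiset.mem_cons.1 h with rfl | h
    · exact Or.inr rfl
    · exact Or.inl h
  | enterSubmit t' p hpc hp => rw [hp]; exact Or.inl (Multiset.mem_cons_of_mem h)
  | _ => exact Or.inl h

/-- An unchanged count says that the push of `t` was not processed in this step, and nothing else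
inserts `t`. So a task that has left the deque does not return. -/
theorem LInv.mem_deque_of_step {i : Fin n} {s s' : LState W} {e : Event n T V} (h : LInv i s)
    (h' : LInv i s') (hst : Step W i s e s') {t : T} (ht : W.owner t = i) (hmem : t ∈ s'.deque i)
    (hcount : W.count (W.pushLetter ht) (W.trace s'.seq) =
      W.count (W.pushLetter ht) (W.trace s.seq)) : t ∈ s.deque i := by
  cases hst with
  | process j sn a hbuf hsn hadm =>
    have hd' := LState.dState_eq h'.mem_L i
    simp only [App.dState_concat] at hd'
    rw [LState.dState_eq h.mem_L i] at hd'
    rcases mem_of_mem_act hd' hmem with ⟨p, hp, htp⟩ | ha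
    · cases hp; exact htp
    · have : a = W.pushLetter ht := Subtype.ext ha
      simp [App.trace_concat, App.count_mul_letter, this] at hcount
  | _ => exact hmem

open Classical in
/-- The number of `popBottom` that process `i` has still to call before `t` leaves its deque. -/
noncomputable def distance (i : Fin n) (t : T) (s : LState W) : ℕ :=
  (s.deque i).idxOf t + ind (¬ Prep i s (.popBottom i))

theorem idxOf_filter_le [DecidableEq T] (p : T → Bool) {t : T} (ht : p t = true) :
    ∀ q : List T, (q.filter p).idxOf t ≤ q.idxOf t
  | [] => le_rfl
  | x :: q => by
    have ih := idxOf_filter_le p ht q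
    by_cases hx : x = t
    · subst hx
      simp [ht]
    · rw [List.idxOf_cons_ne _ hx, List.filter_cons]
      split_ifs
      · rw [List.idxOf_cons_ne _ hx]; omega
      · omega

/-- Entering the local handler cancels the indicator. Processing the pop restores it but moves `t`
one place forward, so the sum is unchanged. Pushes go behind `t`, and removals of other tasks cannot
move it back. -/
theorem LInv.distance_le {i : Fin n} {s s' : LState W} {e : Event n T V} (h : LInv i s)
    (hst : Step W i s e s') (hreg : Regular i s e) {t : T}
    (hle : stored i t s ≤ 1) (hmem : t ∈ s.deque i) (hmem' : t ∈ s'.deque i) :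
    distance i t s' + ind (e = .enterLocal) ≤ distance i t s := by
  classical
  have hpcI := h.pcInv
  unfold PCInv at hpcI
  cases hst with
  | process j sn a hbuf hsn hadm =>
    by_cases hj : j = i
    · subst hj
      obtain ⟨hw, hd⟩ := hreg.process _ _ rfl
      simp only [hw] at hpcI
      rcases hpcI with ⟨_, hc⟩ | ⟨h', _⟩
      swap
      · omega
      have hq := LState.dState_eq h.mem_L j
      obtain ⟨q, hdq⟩ : ∃ q, s.deque j = q := ⟨_, rfl⟩
      rw [hdq] at hq hmem
      simp only [LState.deque, App.trace_concat, App.dState_mul_letter, hq] at hmem'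
      simp only [stored, hdq] at hle
      simp only [distance, hdq, Prep, hw, Function.update_self, hd, hsn]
      simp only [LState.deque, App.trace_concat, App.dState_mul_letter, hq]
      cases hup : (a : Op n T V) with
      | pushBottom l t' =>
        rw [hup] at hc
        obtain ⟨rfl, _⟩ := hc
        simp [act, List.idxOf_append_of_mem hmem]
      | popBottom l =>
        rw [hup] at hc hmem'
        obtain ⟨rfl, hg⟩ := hc
        obtain ⟨x, q, rfl⟩ := List.exists_cons_of_ne_nil (List.ne_nil_of_mem hmem)
        simp only [act, if_true, Option.getD_some] at hmem'
        -- Were the popped head equal to `t`, the copy left in the tail would be a second one.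
        have hx : x ≠ t := by
          rintro rfl
          have := List.count_pos_iff.2 hmem'
          simp only [List.count_cons_self] at hle
          omega
        simp [act, List.idxOf_cons_ne _ hx]
      | remove l t' =>
        rw [hup] at hc hmem'
        obtain ⟨rfl, hg⟩ := hc
        simp only [act, if_true, Option.getD_some] at hmem'
        have htt : decide (t ≠ t') = true := (List.mem_filter.1 hmem').2
        have := idxOf_filter_le (fun x => decide (x ≠ t')) htt q
        simpa [act] using this
      | addResult t' r => simp [act]
    · have hd := hadm.dState_of_ne hj
      simp [distance, LState.deque, hd, Prep, Function.update_of_ne (Ne.symm hj)]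
  | rbroadcast a hpc hadm =>
    simp only [hpc] at hpcI
    simp [distance, LState.deque, Prep, hpc, hpcI.1]
  | abort => exact absurd rfl hreg.abort
  | applyReturn up hpc hdel =>
    have : ∀ up', afterApply up s.out ≠ .call up' ∧ afterApply up s.out ≠ .wait up' := by
      intro up'
      cases up <;> cases s.out <;> simp [afterApply]
    simp [distance, LState.deque, Prep, hpc, hdel, this]
  | invoke => simp [distance, LState.deque, Prep]
  | rdeliver => simp [distance, LState.deque, Prep]
  | enterLocal hpc hg => simp [distance, LState.deque, Prep, hpc]
  | _ => simp_all [distance, LState.deque, Prep]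

/-! ### Every submitted task is executed and published exactly once -/

section Main

variable {m : FaultModel} {f : ℕ} {faulty : Finset (Fin n)} {E : Execution W}

/-- The second law yields a push, and the first law an invocation. -/
theorem Inv.invoked_of_post {i : Fin n} {k : ℕ} (h : Inv E i k) {t : T} (ht : W.owner t = i)
    (hp : Post i (E.state k i) t) : ∃ k' < k, E.At k' i (.invoke t) := by
  have h1 := h.submitted t ht
  have h2 := h.pushed t ht
  simp only [publishing, hp, ind_true] at h2
  exact exists_of_invocations_pos (by omega)

/-- A result that is about to be published is valid, and the task has been executed. -/
theorem IsExecution.executedBetween_of_publish (hE : IsExecution m f faulty E) {i : Fin n}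
    (hi : FollowsCode m faulty i) (hinv : ∀ k, Inv E i k) {k₀ : ℕ} {t : T} (ht : W.owner t = i)
    (honce : ∀ k, E.At k i (.invoke t) → k = k₀) {r : V} (k : ℕ)
    (hpc : (E.state k i).pc = .publish t r) :
    W.Valid t r ∧ ExecutedBetween m faulty E i t k₀ k := by
  induction k with
  | zero => rw [hE.init i hi] at hpc; cases hpc
  | succ k ih =>
    have old : (E.state k i).pc = .publish t r →
        W.Valid t r ∧ ExecutedBetween m faulty E i t k₀ (k + 1) :=
      fun h => ⟨(ih h).1, (ih h).2.mono (by omega)⟩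
    rcases hE.step_or_eq hi k with ⟨e, he, hst⟩ | ⟨_, heq⟩
    · have hpost := fun h => (hinv k).invoked_of_post ht h
      have hres := fun r => hE.executedBetween_of_mem_getResults hi (k := k) (r := r) ht honce
      clear ih
      generalize E.state k i = s at *
      generalize E.state (k + 1) i = s' at *
      cases hst with
      | execute_local t' r' hc hr =>
        cases hpc
        obtain ⟨k', hk', hk''⟩ := hpost (Or.inr (Or.inl hc))
        have := honce _ hk''
        exact ⟨hr, Or.inl ⟨i, hi, k, r, by omega, by omega, he⟩⟩
      | choose t' r' hc hr =>
        cases hpc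
        exact ⟨(hres r hr).1, (hres r hr).2.mono (by omega)⟩
      | invoke => exact old hpc
      | rdeliver => exact old hpc
      | process => exact old hpc
      | applyReturn up hc hdel =>
        cases up <;> cases ho : s.out <;> simp [afterApply, ho] at hpc
      | _ => cases hpc
    · rw [heq] at hpc
      exact old hpc

theorem Inv.publications_le_one {i : Fin n} {k : ℕ} (h : Inv E i k) {t : T} (ht : W.owner t = i) :
    publications E i t k ≤ 1 := by
  have h1 := h.submitted t ht
  have h2 := h.pushed t ht
  have h3 := h.once t
  omega

theorem Inv.publish_unique {i : Fin n} (hinv : ∀ k, Inv E i k) {t : T} (ht : W.owner t = i)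
    {k k' : ℕ} {r r' : V} (h : E.At k i (.publish t r)) (h' : E.At k' i (.publish t r')) :
    k = k' := by
  have key : ∀ {k k' : ℕ} {r r' : V}, E.At k i (.publish t r) → E.At k' i (.publish t r') →
      ¬ k < k' := by
    intro k k' r r' h h' hlt
    have h1 := publications_succ E i t k
    have h2 := publications_succ E i t k'
    have h3 := publications_mono E i t (Nat.succ_le_of_lt hlt)
    have h4 := (hinv (k' + 1)).publications_le_one ht
    have h5 : ∃ r, E.At k i (.publish t r) := ⟨r, h⟩
    have h6 : ∃ r, E.At k' i (.publish t r) := ⟨r', h'⟩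
    simp only [h5, h6, ind_true] at h1 h2
    simp only [Nat.succ_eq_add_one] at h3
    omega
  have := key h h'
  have := key h' h
  omega

theorem Inv.stored_le_one {i : Fin n} {k : ℕ} (h : Inv E i k) {t : T} (ht : W.owner t = i) :
    stored i t (E.state k i) ≤ 1 := by
  have h1 := h.submitted t ht
  have h2 := h.pushed t ht
  have h3 := h.once t
  omega

theorem IsExecution.seq_subset (hE : IsExecution m f faulty E) {i : Fin n}
    (hi : FollowsCode m faulty i) {k k' : ℕ} (hk : k ≤ k') :
    (E.state k i).seq ⊆ (E.state k' i).seq := by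
  induction k', hk using Nat.le_induction with
  | base => exact List.Subset.refl _
  | succ k' hk ih =>
    rcases hE.step_or_eq hi k' with ⟨e, _, hst⟩ | ⟨_, heq⟩
    · exact List.Subset.trans ih hst.seq_subset
    · rw [heq]; exact ih

theorem not_prep_of_idle {i : Fin n} {s : LState W} (h : s.pc = .idle) (up : Op n T V) :
    ¬ Prep i s up := by
  simp [Prep, h]

theorem not_post_of_idle {i : Fin n} {s : LState W} (h : s.pc = .idle) (t : T) :
    ¬ Post i s t := by
  simp [Post, h]

/-- A submitted task is eventually pushed. -/
theorem IsExecution.exists_pushed (hE : IsExecution m f faulty E) {i : Fin n} (hi : i ∉ faulty)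
    (hinv : ∀ k, Inv E i k) (hfree : E.FreeInfOften i) {k₀ : ℕ} {t : T} (ht : W.owner t = i)
    (honce : ∀ k, E.At k i (.invoke t) → k = k₀) (hk₀ : E.At k₀ i (.invoke t)) :
    ∃ k, W.pushLetter ht ∈ (E.state k i).seq := by
  classical
  have hF : FollowsCode m faulty i := followsCode_of_notMem hi
  obtain ⟨k₁, hk₁, hpend⟩ : ∃ k ≥ k₀ + 1, t ∉ (E.state k i).pending := by
    -- If `t` waited forever, fairness would let one copy enter while another stays in `pending`:
    -- two submissions against one invocation.
    by_contra! hp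
    obtain ⟨k, hk, he⟩ := (hE.fair i hi).submit (k₀ + 1) t hfree hp
    have hmem := hp (k + 1) (by omega)
    have h1 := (hinv (k + 1)).submitted t ht
    have h2 := (hinv (k + 1)).once t
    have hst := hE.step i hF k _ he
    have hprep : Prep i (E.state (k + 1) i) (.pushBottom i t) := by
      generalize E.state k i = s at hst
      generalize E.state (k + 1) i = s' at hst
      cases hst
      exact Or.inl rfl
    have h3 := Multiset.count_pos.2 hmem
    simp only [submitting, hprep, ind_true] at h1
    omega
  have hstay : ∀ k ≥ k₁, t ∉ (E.state k i).pending := by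
    intro k hk
    induction k, hk using Nat.le_induction with
    | base => exact hpend
    | succ k hk ih =>
      intro hmem
      rcases hE.step_or_eq hF k with ⟨e, he, hst⟩ | ⟨_, heq⟩
      · rcases hst.mem_pending hmem with h | rfl
        · exact ih h
        · have := honce k he
          omega
      · rw [heq] at hmem
        exact ih hmem
  -- At a free moment no push is in preparation, so the first law finds the submission in `seq`.
  obtain ⟨k₂, hk₂, hidle⟩ := hfree k₁
  refine ⟨k₂, ?_⟩
  rw [← App.count_pos_iff]
  have h1 := (hinv k₂).submitted t ht
  have h2 := invocations_succ E i t k₀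
  have h3 := invocations_mono E i t (show k₀ + 1 ≤ k₂ by omega)
  simp only [hk₀, ind_true] at h2
  simp only [submitting, not_prep_of_idle hidle, ind_false, Multiset.count_eq_zero.2 (hstay k₂ hk₂)] at h1
  omega

/-- A task does not stay in the deque forever. -/
theorem IsExecution.exists_notMem_deque (hE : IsExecution m f faulty E) {i : Fin n} (hi : i ∉ faulty)
    (hinv : ∀ k, Inv E i k) (hreg : ∀ k e, E.At k i e → Regular i (E.state k i) e)
    (hfree : E.FreeInfOften i) {t : T} (ht : W.owner t = i) (K : ℕ) :
    ∃ k ≥ K, t ∉ (E.state k i).deque i := by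
  by_contra! hmem
  have hF : FollowsCode m faulty i := followsCode_of_notMem hi
  have hstep : ∀ k ≥ K, distance i t (E.state (k + 1) i) + ind (E.At k i .enterLocal) ≤
      distance i t (E.state k i) := by
    intro k hk
    rcases hE.step_or_eq hF k with ⟨e, he, hst⟩ | ⟨hno, heq⟩
    · have h1 := (hinv k).loc.distance_le hst (hreg k e he) ((hinv k).stored_le_one ht)
        (hmem k hk) (hmem (k + 1) (by omega))
      have h2 : E.At k i .enterLocal ↔ e = .enterLocal := ⟨fun h => he.eq h, fun h => h ▸ he⟩
      rw [h2]
      exact h1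
    · rw [heq]
      simp [hno]
  have hanti : ∀ k ≥ K, ∀ k' ≥ k,
      distance i t (E.state k' i) ≤ distance i t (E.state k i) := by
    intro k hk k' hk'
    induction k', hk' using Nat.le_induction with
    | base => exact le_rfl
    | succ k' hk' ih =>
      have := hstep k' (by omega)
      omega
  -- Descent: a deque containing `t` is nonempty, so `enterLocal` recurs and lowers `distance` each
  -- time.
  have key : ∀ d, ∀ k ≥ K, distance i t (E.state k i) ≠ d := by
    intro d
    induction d using Nat.strong_induction_on with
    | _ d ih =>
      intro k hk hd
      obtain ⟨k', hk', he⟩ := (hE.fair i hi).localTask k hfree (fun k' hk' => by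
        rw [LState.guardLocal_iff (hinv k').loc.mem_L]
        exact List.ne_nil_of_mem (hmem k' (by omega)))
      have h1 := hstep k' (by omega)
      have h2 := hanti k hk k' hk'
      simp only [he, ind_true] at h1
      exact ih _ (by omega) (k' + 1) (by omega) rfl
  exact key _ K le_rfl rfl

/-- A submitted task is eventually published. -/
theorem IsExecution.exists_publish (hE : IsExecution m f faulty E) {i : Fin n} (hi : i ∉ faulty)
    (hinv : ∀ k, Inv E i k) (hreg : ∀ k e, E.At k i e → Regular i (E.state k i) e)
    (hfree : E.FreeInfOften i) {k₀ : ℕ} {t : T} (ht : W.owner t = i)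
    (honce : ∀ k, E.At k i (.invoke t) → k = k₀) (hk₀ : E.At k₀ i (.invoke t)) :
    ∃ k r, E.At k i (.publish t r) := by
  classical
  have hF : FollowsCode m faulty i := followsCode_of_notMem hi
  obtain ⟨k₁, hk₁⟩ := hE.exists_pushed hi hinv hfree ht honce hk₀
  have hcount : ∀ k ≥ k₁, W.count (W.pushLetter ht) (W.trace (E.state k i).seq) = 1 := by
    intro k hk
    have h1 := (App.count_pos_iff _ _).2 (hE.seq_subset hF hk hk₁)
    have h2 := (hinv k).submitted t ht
    have h3 := (hinv k).once t
    omega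
  obtain ⟨k₂, hk₂, hout⟩ := hE.exists_notMem_deque hi hinv hreg hfree ht k₁
  have hstay : ∀ k ≥ k₂, t ∉ (E.state k i).deque i := by
    intro k hk
    induction k, hk using Nat.le_induction with
    | base => exact hout
    | succ k hk ih =>
      intro hmem
      rcases hE.step_or_eq hF k with ⟨e, he, hst⟩ | ⟨_, heq⟩
      · exact ih ((hinv k).loc.mem_deque_of_step (hinv (k + 1)).loc hst ht hmem
          (by rw [hcount k (by omega), hcount (k + 1) (by omega)]))
      · rw [heq] at hmem
        exact ih hmem
  -- At a free moment after `t` has left the deque, both other terms of the second law vanish, and a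
  -- past publication remains.
  obtain ⟨k₃, hk₃, hidle⟩ := hfree k₂
  have h1 := (hinv k₃).pushed t ht
  rw [hcount k₃ (by omega)] at h1
  simp only [publishing, not_post_of_idle hidle, ind_false, stored,
    List.count_eq_zero.2 (hstay k₃ hk₃)] at h1
  obtain ⟨k, _, r, h⟩ := exists_of_publications_pos (E := E) (i := i) (t := t) (k := k₃) (by omega)
  exact ⟨k, r, h⟩

theorem Step.publish_inv {i : Fin n} {t : T} {r : V} {s s' : LState W}
    (h : Step W i s (.publish t r) s') : s.pc = .publish t r := by
  cases h with
  | publish t r hpc => exact hpc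

end Main

end WorkStealing

theorem mainTheorem7 {n : ℕ} {T : Type*} {V : Type*} (W : WorkStealing.App n T V)
    -- every task has a valid result, so that `execute(t)` can return one
    (hvalid : ∀ t, ∃ r, W.Valid t r)
    (m : WorkStealing.FaultModel) (f : ℕ) (faulty : Finset (Fin n))
    (E : WorkStealing.Execution W) (hE : WorkStealing.IsExecution m f faulty E)
    (i : Fin n) (hi : i ∉ faulty)
    -- `i` only submits its own tasks, and none of them twice
    (howner : ∀ k t, E.At k i (.invoke t) → W.owner t = i)
    (honce : ∀ k k' t, E.At k i (.invoke t) → E.At k' i (.invoke t) → k = k')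
    -- `i` submits finitely many tasks
    (hfin : {k | ∃ t, E.At k i (.invoke t)}.Finite) :
    ∀ k t, E.At k i (.invoke t) →
      ∃ k' r, k < k' ∧ E.At k' i (.publish t r) ∧ W.Valid t r ∧
        WorkStealing.ExecutedBetween m faulty E i t k k' ∧
        ∀ k'' r', E.At k'' i (.publish t r') → k'' = k' := by
  intro k t hk
  have hF := WorkStealing.followsCode_of_notMem (m := m) hi
  have ht := howner k t hk
  have honce' : ∀ k', E.At k' i (.invoke t) → k' = k := fun k' h => honce k' k t h hk
  have hinv := hE.inv hF howner honce
  have hreg := fun k e he => (hinv k).regular hE hF howner (e := e) he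
  have hfree := hE.freeInfOften hvalid hi hinv hreg
  obtain ⟨k', r, hpub⟩ := hE.exists_publish hi hinv hreg hfree ht honce' hk
  have hpc := (hE.step i hF k' _ hpub).publish_inv
  obtain ⟨k'', hk'', hinvoke⟩ :=
    (hinv k').invoked_of_post ht (Or.inr (Or.inr (Or.inr ⟨r, hpc⟩)))
  obtain ⟨hv, hex⟩ := hE.executedBetween_of_publish hF hinv ht honce' k' hpc
  refine ⟨k', r, by rw [← honce' _ hinvoke]; exact hk'', hpub, hv, hex, fun l r' h => ?_⟩
  exact WorkStealing.Inv.publish_unique hinv ht h hpub
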